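/- Let $q$ be a complex number with $0<|q|<1$, fix a square root $q^{1/2}$ of $q$, and put $q^{n/2}:=(q^{1/2})^n$ for integers $n$. Write $(a;q)_\infty=\prod_{j\ge 0}(1-aq^j)$, $(a;q)_k=(a;q)_\infty/(aq^k;q)_\infty$ for $k\in\mathbb Z$, $(a)_k=(a;q)_k$ (for $k$ an integer or $\infty$), $(a_1,a_2,a_3;q)_\infty=(a_1;q)_\infty(a_2;q)_\infty(a_3;q)_\infty$, and $$\left[{N\atop j}\right]=\frac{(q)_N}{(q)_j(q)_{N-j}}\quad\text{for } 0\le j\le N,\qquad \left[{N\atop j}\right]=0\quad\text{for } j<0 \text{ or } j>N .$$ Let $m\ge 0$, $r\ge 2$ and $0\le i\le r-1$ be integers. Then, where the sum is over all integer vectors $(s_1,\dots,s_r)$ with $s_1\ge\cdots\ge s_r\ge-\lfloor m/2\rfloor$ and converges absolutely, $$\sum_{s_1\ge\cdots\ge s_r\ge-\lfloor m/2\rfloor}\frac{q^{s_1^2+\cdots+s_r^2+m(s_1+\cdots+s_r)-s_1-\cdots-s_i-(m+1)s_r/2}\,\bigl(-q^{(m+1)/2}\bigr)_{s_r}}{(q)_{s_1-s_2}\cdots(q)_{s_{r-1}-s_r}\,\bigl(-q^{(m+1)/2}\bigr)_{s_{r-1}}}\,(-1)^{s_r}\left[{m+s_r\atop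 m+2s_r}\right]$$ $$=\sum_{k=0}^{i}q^{mk}\,\frac{\bigl(q^{2r},\,q^{(m+1)r-i+2k-(m+1)/2},\,q^{(1-m)r+i-2k+(m+1)/2};\,q^{2r}\bigr)_\infty}{(q)_\infty}.$$ -/

import Mathlib

/-- The infinite `q`-shifted factorial `(a; q)_∞ = ∏_{j ≥ 0} (1 - a q^j)`, for complex `a` and
`q` (the product converges absolutely whenever `|q| < 1`). -/
noncomputable def qPochInf (a q : ℂ) : ℂ := ∏' j : ℕ, (1 - a * q ^ j)

/-- The `q`-shifted factorial `(a; q)_k = (a; q)_∞ / (a q^k; q)_∞` for an integer `k`. -/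
noncomputable def qPoch (a q : ℂ) (k : ℤ) : ℂ := qPochInf a q / qPochInf (a * q ^ k) q

/-- The product of three infinite `q`-shifted factorials,
`(a, b, c; q)_∞ = (a; q)_∞ (b; q)_∞ (c; q)_∞`. -/
noncomputable def qPochInf₃ (a b c q : ℂ) : ℂ := qPochInf a q * qPochInf b q * qPochInf c q

/-- The `q`-binomial coefficient `(q)_N / ((q)_j (q)_{N-j})` for `0 ≤ j ≤ N`, and `0` for all
other integers `j`. -/
noncomputable def qBinom (q : ℂ) (N j : ℤ) : ℂ :=
  if 0 ≤ j ∧ j ≤ N then qPoch q q N / (qPoch q q j * qPoch q q (N - j)) else 0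

/-- The index set of the multisum: integer vectors `(s_1, …, s_r)` with
`s_1 ≥ s_2 ≥ ⋯ ≥ s_r ≥ -⌊m/2⌋`; the entry `s_j` is `s ⟨j - 1, _⟩`. -/
def multisumIndex (m r : ℕ) : Set (Fin r → ℤ) :=
  {s | Antitone s ∧ ∀ j, -((m / 2 : ℕ) : ℤ) ≤ s j}

open Filter Topology

/-! The engine is a bilateral Bailey lattice, with p = q^{1/2}. Put K_{m,k}(n) = 1/((q)_{n-k}
(q)_{n+m+k}) and consider sequences β_n = ∑_{k∈ℤ} α_k K_{m,k}(n). Multiplying β_x by a suitable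
weight and by 1/(q)_{n-x}, then summing over x, gives a sequence of the same kind with new α. On a
single kernel this is a terminating q-Chu–Vandermonde sum (`sum_qFacInv_vandermonde`). The initial
pair α_k = (-1)^k p^{k(k-1)}, β_n = (-1)^n p^{n(n-1)} [m+n; m+2n] is the q-binomial theorem
(`hasSum_basePair`).

The multisum is summed from s_r outwards. The s_r-sum has weight p^{x²+mx} (-p^{m+1})_x, and the
factor (-p^{m+1})_{s_{r-1}} it produces cancels the denominator (`tsum_cutWeight_mul_unitBailey`).
The sums over s_{r-1}, …, s_{i+1} have weight q^{x²+mx} and keep each kernel up to a scalar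
(`hasSum_baileyKernel`). The sums over s_i, …, s_1 have weight q^{x²+(m-1)x} and also create
K_{m-1,k+1}; after i of them its coefficient is y + ⋯ + y^i, where y = q^{m+2k}
(`hasSum_baileyKernel_lowered_iterate`).

For the outermost sum n → ∞, and both kernels tend to 1/(q)_∞². What remains is ∑_k (-1)^k
p^{2rk²+bk} (1 + y + ⋯ + y^i) / (q)_∞. Each y^l only shifts b and contributes q^{ml}, so the i+1
theta series are summed by the Jacobi triple product in base q^{2r}, itself obtained from the kernel
at m = 0. -/

/-- The reciprocal `1 / (q; q)_k`, which vanishes for negative `k`. -/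
noncomputable def qFacInv (q : ℂ) (k : ℤ) : ℂ := qPochInf (q * q ^ k) q / qPochInf q q

theorem inv_qPoch_self (q : ℂ) (k : ℤ) : (qPoch q q k)⁻¹ = qFacInv q k := by
  rw [qPoch, qFacInv, inv_div]

/-! ### Infinite q-products: nonvanishing, splitting and tails. -/

section infiniteProduct

variable {q : ℂ}

theorem summable_norm_qPochInf_factor (hq : ‖q‖ < 1) (a : ℂ) :
    Summable fun j : ℕ => ‖-(a * q ^ j)‖ := by
  simpa [norm_mul, norm_pow] using
    (summable_geometric_of_lt_one (norm_nonneg q) hq).mul_left ‖a‖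

theorem multipliable_qPochInf (hq : ‖q‖ < 1) (a : ℂ) :
    Multipliable fun j : ℕ => 1 - a * q ^ j := by
  simpa [sub_eq_add_neg] using
    multipliable_one_add_of_summable (summable_norm_qPochInf_factor hq a)

theorem qPochInf_ne_zero (hq : ‖q‖ < 1) {a : ℂ} (h : ∀ j : ℕ, 1 - a * q ^ j ≠ 0) :
    qPochInf a q ≠ 0 := by
  have := tprod_one_add_ne_zero_of_summable (f := fun j : ℕ => -(a * q ^ j))
    (by simpa [sub_eq_add_neg] using h) (summable_norm_qPochInf_factor hq a)
  simpa [qPochInf, sub_eq_add_neg] using this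

theorem qPochInf_ne_zero_of_norm_lt_one (hq : ‖q‖ < 1) {a : ℂ} (ha : ‖a‖ < 1) :
    qPochInf a q ≠ 0 := by
  refine qPochInf_ne_zero hq fun j h => ?_
  have h1 : ‖a * q ^ j‖ < 1 := by
    rw [norm_mul, norm_pow]
    exact mul_lt_one_of_nonneg_of_lt_one_left (norm_nonneg _) ha
      (pow_le_one₀ (norm_nonneg _) hq.le)
  rw [← sub_eq_zero.1 h] at h1
  simp at h1

theorem qPochInf_eq_mul (hq : ‖q‖ < 1) (a : ℂ) :
    qPochInf a q = (1 - a) * qPochInf (a * q) q := by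
  have e : (fun j : ℕ => 1 - a * q * q ^ j) = fun j : ℕ => 1 - a * q ^ (j + 1) := by
    funext j; ring
  have h := multipliable_qPochInf hq (a * q)
  rw [e] at h
  have h2 : qPochInf (a * q) q = ∏' j : ℕ, (1 - a * q ^ (j + 1)) := by
    unfold qPochInf; rw [e]
  have h3 : qPochInf a q = ∏' j : ℕ, (1 - a * q ^ j) := by rw [qPochInf]
  rw [h2, h3, tprod_eq_zero_mul' (f := fun j : ℕ => 1 - a * q ^ j) h, pow_zero, mul_one]

theorem qPochInf_eq_prod_mul (hq : ‖q‖ < 1) (a : ℂ) (n : ℕ) :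
    qPochInf a q = (∏ t ∈ Finset.range n, (1 - a * q ^ t)) * qPochInf (a * q ^ n) q := by
  induction n with
  | zero => simp
  | succ n ih =>
    rw [ih, Finset.prod_range_succ, qPochInf_eq_mul hq (a * q ^ n), pow_succ]
    ring_nf

theorem tendsto_prod_qPochInf (hq : ‖q‖ < 1) (a : ℂ) :
    Tendsto (fun n : ℕ => ∏ t ∈ Finset.range n, (1 - a * q ^ t)) atTop (𝓝 (qPochInf a q)) :=
  (multipliable_qPochInf hq a).hasProd.tendsto_prod_nat

/-- The tail is the full product divided by a partial product; boundedness of the tails and of their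
inverses follows. -/
theorem tendsto_qPochInf_mul_pow (hq : ‖q‖ < 1) {a : ℂ} (ha : qPochInf a q ≠ 0) :
    Tendsto (fun n : ℕ => qPochInf (a * q ^ n) q) atTop (𝓝 1) := by
  have h := (tendsto_const_nhds (x := qPochInf a q)).div (tendsto_prod_qPochInf hq a) ha
  rw [div_self ha] at h
  refine h.congr fun n => ?_
  have h2 := qPochInf_eq_prod_mul hq a n
  have h3 : ∏ t ∈ Finset.range n, (1 - a * q ^ t) ≠ 0 := by
    intro h0; rw [h0, zero_mul] at h2; exact ha h2
  simp only [Pi.div_apply]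
  rw [div_eq_iff h3, h2]; ring

theorem exists_bound_qPochInf_mul_pow (hq : ‖q‖ < 1) {a : ℂ} (ha : qPochInf a q ≠ 0) :
    ∃ C, ∀ n : ℕ, ‖qPochInf (a * q ^ n) q‖ ≤ C := by
  obtain ⟨C, hC⟩ := (Metric.isBounded_range_of_tendsto _
    (tendsto_qPochInf_mul_pow hq ha)).exists_norm_le
  exact ⟨C, fun n => hC _ ⟨n, rfl⟩⟩

theorem exists_bound_inv_qPochInf_mul_pow (hq : ‖q‖ < 1) {a : ℂ} (ha : qPochInf a q ≠ 0) :
    ∃ C, ∀ n : ℕ, ‖(qPochInf (a * q ^ n) q)⁻¹‖ ≤ C := by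
  obtain ⟨C, hC⟩ := (Metric.isBounded_range_of_tendsto _
    ((tendsto_qPochInf_mul_pow hq ha).inv₀ one_ne_zero)).exists_norm_le
  exact ⟨C, fun n => hC _ ⟨n, rfl⟩⟩

end infiniteProduct

/-! ### Reciprocal q-factorials at integer arguments. -/

section qFacInv

variable {q : ℂ}

theorem qPochInf_self_ne_zero (hq : ‖q‖ < 1) : qPochInf q q ≠ 0 :=
  qPochInf_ne_zero_of_norm_lt_one hq hq

theorem one_sub_zpow_mul_qFacInv (hq0 : q ≠ 0) (hq : ‖q‖ < 1) (k : ℤ) :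
    (1 - q ^ k) * qFacInv q k = qFacInv q (k - 1) := by
  have h : q * q ^ (k - 1) = q ^ k := by rw [← zpow_one_add₀ hq0]; congr 1; ring
  rw [qFacInv, qFacInv, h, qPochInf_eq_mul hq (q ^ k), mul_comm q, mul_div_assoc]

theorem qFacInv_zero (hq : ‖q‖ < 1) : qFacInv q 0 = 1 := by
  simp [qFacInv, qPochInf_self_ne_zero hq]

theorem qFacInv_neg (hq0 : q ≠ 0) {k : ℤ} (hk : k < 0) : qFacInv q k = 0 := by
  rw [qFacInv, qPochInf, tprod_of_exists_eq_zero, zero_div]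
  -- The factor with index j = -1-k is 1 - q^{1+k+j} = 0.
  refine ⟨(-1 - k).toNat, ?_⟩
  have h : ((-1 - k).toNat : ℤ) = -1 - k := Int.toNat_of_nonneg (by omega)
  rw [← zpow_natCast, h, ← zpow_one_add₀ hq0, ← zpow_add₀ hq0]
  simp

theorem qFacInv_natCast_ne_zero (hq : ‖q‖ < 1) (n : ℕ) : qFacInv q n ≠ 0 := by
  refine div_ne_zero (qPochInf_ne_zero_of_norm_lt_one hq ?_) (qPochInf_self_ne_zero hq)
  rw [zpow_natCast, ← pow_succ', norm_pow]
  exact pow_lt_one₀ (norm_nonneg _) hq (by simp)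

theorem qFacInv_ne_zero (hq : ‖q‖ < 1) {k : ℤ} (hk : 0 ≤ k) : qFacInv q k ≠ 0 := by
  lift k to ℕ using hk
  exact qFacInv_natCast_ne_zero hq k

theorem qPoch_self_eq (k : ℤ) : qPoch q q k = (qFacInv q k)⁻¹ := by
  rw [← inv_qPoch_self, inv_inv]

theorem tendsto_qFacInv (hq : ‖q‖ < 1) :
    Tendsto (qFacInv q) atTop (𝓝 (qPochInf q q)⁻¹) := by
  rw [← tendsto_comp_val_Ici_atTop (a := (0 : ℤ))]
  have h := (tendsto_qPochInf_mul_pow hq (qPochInf_self_ne_zero hq)).div_const (qPochInf q q)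
  have h2 : Tendsto (fun x : Set.Ici (0 : ℤ) => (x : ℤ).toNat) atTop atTop := by
    rw [tendsto_atTop]
    intro b
    filter_upwards [eventually_ge_atTop (⟨b, by simp⟩ : Set.Ici (0 : ℤ))] with x hx
    have : (b : ℤ) ≤ x := hx
    omega
  rw [one_div] at h
  refine (h.comp h2).congr fun x => ?_
  have : (((x : ℤ).toNat : ℕ) : ℤ) = x := Int.toNat_of_nonneg x.2
  simp only [Function.comp, qFacInv]
  rw [← zpow_natCast, this]

theorem exists_bound_qFacInv (hq0 : q ≠ 0) (hq : ‖q‖ < 1) :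
    ∃ C, 0 ≤ C ∧ ∀ k, ‖qFacInv q k‖ ≤ C := by
  obtain ⟨C, hC⟩ := exists_bound_qPochInf_mul_pow hq (qPochInf_self_ne_zero hq)
  have hC0 : 0 ≤ C := (norm_nonneg _).trans (hC 0)
  refine ⟨C / ‖qPochInf q q‖, by positivity, fun k => ?_⟩
  rcases lt_or_ge k 0 with hk | hk
  · rw [qFacInv_neg hq0 hk, norm_zero]; positivity
  · lift k to ℕ using hk
    rw [qFacInv, norm_div, zpow_natCast]
    gcongr
    exact hC k

end qFacInv

/-! ### Terminating q-Vandermonde and q-binomial sums. -/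

section finiteIdentities

variable {q : ℂ}

/-- A `q`-Chu–Vandermonde summation. -/
theorem sum_qFacInv_vandermonde (hq0 : q ≠ 0) (hq : ‖q‖ < 1) (N : ℕ) (M : ℤ) (z : ℂ) :
    ∑ l ∈ Finset.range (N + 1), (-1) ^ l * q ^ (l.choose 2)
        * (∏ t ∈ Finset.range l, (z - q ^ (M + 1 + t)))
        * (qFacInv q (N - l) * qFacInv q l * qFacInv q (l + M))
      = (∏ t ∈ Finset.range N, (1 - z * q ^ t)) * (qFacInv q N * qFacInv q (N + M)) := by
  induction N generalizing M z with
  | zero => simp [qFacInv_zero hq]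
  | succ N ih =>
    have hN : (1 - q ^ ((N + 1 : ℕ) : ℤ)) ≠ 0 := by
      intro h
      have := one_sub_zpow_mul_qFacInv hq0 hq ((N + 1 : ℕ) : ℤ)
      rw [h, zero_mul] at this
      refine qFacInv_natCast_ne_zero hq N ?_
      rw [this]; congr 1; push_cast; ring
    have hprod : ∀ l : ℕ, ∏ t ∈ Finset.range l, (q * z - q ^ (M + 1 + 1 + t))
        = q ^ l * ∏ t ∈ Finset.range l, (z - q ^ (M + 1 + t)) := by
      intro l
      have hpow : q ^ l = ∏ _t ∈ Finset.range l, q := by simp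
      rw [hpow, ← Finset.prod_mul_distrib]
      refine Finset.prod_congr rfl fun t _ => ?_
      rw [show M + 1 + 1 + (t : ℤ) = 1 + (M + 1 + t) by ring, zpow_one_add₀ hq0]; ring
    refine mul_left_cancel₀ hN ?_
    -- Lowering N by one replaces (z, M) by (qz, M+1) at the cost of the factor 1 - z.
    have key : (1 - q ^ ((N + 1 : ℕ) : ℤ)) *
        ∑ l ∈ Finset.range (N + 1 + 1), (-1) ^ l * q ^ (l.choose 2)
        * (∏ t ∈ Finset.range l, (z - q ^ (M + 1 + t)))
        * (qFacInv q ((N + 1 : ℕ) - l) * qFacInv q l * qFacInv q (l + M))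
      = (1 - z) * ∑ l ∈ Finset.range (N + 1), (-1) ^ l * q ^ (l.choose 2)
        * (∏ t ∈ Finset.range l, (q * z - q ^ (M + 1 + 1 + t)))
        * (qFacInv q (N - l) * qFacInv q l * qFacInv q (l + (M + 1))) := by
      -- Here 1 - q^{N+1} = (1 - q^l) + q^l (1 - q^{N+1-l}), and each bracket lowers one reciprocal
      -- factorial. After shifting l in the first half, the two halves combine through (1 -
      -- q^{M+1+l}) - (z - q^{M+1+l}) = 1 - z.
      have split : ∀ l : ℕ, (1 - q ^ ((N + 1 : ℕ) : ℤ)) * ((-1) ^ l * q ^ (l.choose 2)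
        * (∏ t ∈ Finset.range l, (z - q ^ (M + 1 + t)))
        * (qFacInv q ((N + 1 : ℕ) - l) * qFacInv q l * qFacInv q (l + M)))
        = (-1) ^ l * q ^ (l.choose 2)
          * (∏ t ∈ Finset.range l, (z - q ^ (M + 1 + t)))
          * (qFacInv q ((N + 1 : ℕ) - l) * qFacInv q (l - 1) * qFacInv q (l + M))
         + (-1) ^ l * q ^ (l.choose 2)
          * (∏ t ∈ Finset.range l, (z - q ^ (M + 1 + t)))
          * q ^ l * (qFacInv q ((N + 1 : ℕ) - l - 1) * qFacInv q l * qFacInv q (l + M)) := by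
        intro l
        rw [← one_sub_zpow_mul_qFacInv hq0 hq (l : ℤ),
          ← one_sub_zpow_mul_qFacInv hq0 hq (((N + 1 : ℕ) : ℤ) - l), zpow_sub₀ hq0,
          zpow_natCast q l]
        have := pow_ne_zero l hq0
        field_simp
        ring
      rw [Finset.mul_sum, Finset.sum_congr rfl fun l _ => split l, Finset.sum_add_distrib,
        Finset.sum_range_succ', Finset.sum_range_succ (n := N + 1), Finset.mul_sum]
      rw [qFacInv_neg hq0 (k := ((0 : ℕ) : ℤ) - 1) (by simp),
        qFacInv_neg hq0 (k := ((N + 1 : ℕ) : ℤ) - ((N + 1 : ℕ) : ℤ) - 1) (by simp)]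
      simp only [mul_zero, zero_mul, add_zero]
      rw [← Finset.sum_add_distrib]
      refine Finset.sum_congr rfl fun l _ => ?_
      have e1 : (((N + 1 : ℕ) : ℤ) - ((l + 1 : ℕ) : ℤ)) = N - l := by push_cast; ring
      have e2 : (((N + 1 : ℕ) : ℤ) - (l : ℤ) - 1) = N - l := by push_cast; ring
      have e3 : (((l + 1 : ℕ) : ℤ) - 1) = l := by push_cast; ring
      have e4 : (((l + 1 : ℕ) : ℤ) + M) = l + (M + 1) := by push_cast; ring
      have e5 : ((l : ℤ) + M) = l + (M + 1) - 1 := by ring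
      rw [hprod, e1, e2, e3, e4, e5, ← one_sub_zpow_mul_qFacInv hq0 hq (l + (M + 1)),
        Finset.prod_range_succ, Nat.choose_succ_succ' l 1, Nat.choose_one_right, pow_add, pow_succ,
        show (l : ℤ) + (M + 1) = M + 1 + l by ring]
      ring
    rw [key, ih, Finset.prod_range_succ']
    have e6 : (((N + 1 : ℕ) : ℤ) - 1) = N := by push_cast; ring
    have h1 := one_sub_zpow_mul_qFacInv hq0 hq ((N + 1 : ℕ) : ℤ)
    rw [e6] at h1
    rw [← h1, show ((N + 1 : ℕ) : ℤ) + M = N + (M + 1) by push_cast; ring]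
    simp only [pow_succ, pow_zero]
    have e7 : ∀ t : ℕ, z * (q ^ t * q) = q * z * q ^ t := fun t => by ring
    simp only [e7]
    ring

/-- The finite `q`-binomial theorem. -/
theorem sum_qFacInv_binomial (hq0 : q ≠ 0) (hq : ‖q‖ < 1) (N : ℕ) (z : ℂ) :
    ∑ l ∈ Finset.range (N + 1), (-z) ^ l * q ^ (l.choose 2) * (qFacInv q (N - l) * qFacInv q l)
      = (∏ t ∈ Finset.range N, (1 - z * q ^ t)) * qFacInv q N := by
  induction N generalizing z with
  | zero => simp [qFacInv_zero hq]
  | succ N ih =>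
    have hN : (1 - q ^ ((N + 1 : ℕ) : ℤ)) ≠ 0 := by
      intro h
      have := one_sub_zpow_mul_qFacInv hq0 hq ((N + 1 : ℕ) : ℤ)
      rw [h, zero_mul] at this
      refine qFacInv_natCast_ne_zero hq N ?_
      rw [this]; congr 1; push_cast; ring
    refine mul_left_cancel₀ hN ?_
    have key : (1 - q ^ ((N + 1 : ℕ) : ℤ)) *
        ∑ l ∈ Finset.range (N + 1 + 1), (-z) ^ l * q ^ (l.choose 2)
        * (qFacInv q ((N + 1 : ℕ) - l) * qFacInv q l)
      = (1 - z) * ∑ l ∈ Finset.range (N + 1), (-(q * z)) ^ l * q ^ (l.choose 2)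
        * (qFacInv q (N - l) * qFacInv q l) := by
      have split : ∀ l : ℕ, (1 - q ^ ((N + 1 : ℕ) : ℤ)) * ((-z) ^ l * q ^ (l.choose 2)
        * (qFacInv q ((N + 1 : ℕ) - l) * qFacInv q l))
        = (-z) ^ l * q ^ (l.choose 2) * (qFacInv q ((N + 1 : ℕ) - l) * qFacInv q (l - 1))
         + (-z) ^ l * q ^ (l.choose 2)
          * q ^ l * (qFacInv q ((N + 1 : ℕ) - l - 1) * qFacInv q l) := by
        intro l
        rw [← one_sub_zpow_mul_qFacInv hq0 hq (l : ℤ),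
          ← one_sub_zpow_mul_qFacInv hq0 hq (((N + 1 : ℕ) : ℤ) - l), zpow_sub₀ hq0,
          zpow_natCast q l]
        have := pow_ne_zero l hq0
        field_simp
        ring
      rw [Finset.mul_sum, Finset.sum_congr rfl fun l _ => split l, Finset.sum_add_distrib,
        Finset.sum_range_succ', Finset.sum_range_succ (n := N + 1), Finset.mul_sum]
      rw [qFacInv_neg hq0 (k := ((0 : ℕ) : ℤ) - 1) (by simp),
        qFacInv_neg hq0 (k := ((N + 1 : ℕ) : ℤ) - ((N + 1 : ℕ) : ℤ) - 1) (by simp)]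
      simp only [mul_zero, zero_mul, add_zero]
      rw [← Finset.sum_add_distrib]
      refine Finset.sum_congr rfl fun l _ => ?_
      have e1 : (((N + 1 : ℕ) : ℤ) - ((l + 1 : ℕ) : ℤ)) = N - l := by push_cast; ring
      have e2 : (((N + 1 : ℕ) : ℤ) - (l : ℤ) - 1) = N - l := by push_cast; ring
      have e3 : (((l + 1 : ℕ) : ℤ) - 1) = l := by push_cast; ring
      rw [e1, e2, e3, Nat.choose_succ_succ' l 1, Nat.choose_one_right, pow_add, pow_succ,
        neg_mul_eq_mul_neg, mul_pow]
      ring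
    rw [key, ih, Finset.prod_range_succ']
    have e6 : (((N + 1 : ℕ) : ℤ) - 1) = N := by push_cast; ring
    have h1 := one_sub_zpow_mul_qFacInv hq0 hq ((N + 1 : ℕ) : ℤ)
    rw [e6] at h1
    rw [← h1]
    simp only [pow_succ, pow_zero]
    have e7 : ∀ t : ℕ, z * (q ^ t * q) = q * z * q ^ t := fun t => by ring
    simp only [e7]
    ring

end finiteIdentities

/-! ### The Bailey kernel and its plain and lowered summations. -/

/-- The kernel `1 / ((q; q)_{n-k} (q; q)_{n+m+k})` of a bilateral Bailey pair relative to `q^m`. -/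
noncomputable def baileyKernel (q : ℂ) (m k n : ℤ) : ℂ := qFacInv q (n - k) * qFacInv q (n + m + k)

theorem baileyKernel_symm (q : ℂ) (m k n : ℤ) :
    baileyKernel q m (-m - k) n = baileyKernel q m k n := by
  rw [baileyKernel, baileyKernel, mul_comm]
  congr 2 <;> ring

theorem hasSum_int_of_support {F : ℤ → ℂ} (k : ℤ) (N : ℕ) (h1 : ∀ j < k, F j = 0)
    (h2 : ∀ j, k + N < j → F j = 0) :
    HasSum F (∑ l ∈ Finset.range (N + 1), F (k + l)) := by
  have hinj : Function.Injective fun l : ℕ => k + (l : ℤ) := fun a b h => by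
    simpa using h
  rw [← hinj.hasSum_iff]
  · refine hasSum_sum_of_ne_finset_zero fun l hl => h2 _ ?_
    simp only [Finset.mem_range] at hl
    show k + (N : ℤ) < k + (l : ℤ)
    omega
  · intro x hx
    refine h1 x ?_
    by_contra hlt
    exact hx ⟨(x - k).toNat, by simp only; omega⟩

theorem two_mul_choose_two (l : ℕ) : (2 * (l.choose 2 : ℤ)) = l * l - l := by
  induction l with
  | zero => simp
  | succ l ih =>
    rw [Nat.choose_succ_succ' l 1, Nat.choose_one_right]
    push_cast
    linarith

section bailey

variable {q : ℂ}

theorem prod_zpow_add_natCast (hq0 : q ≠ 0) (A : ℤ) (l : ℕ) :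
    ∏ t ∈ Finset.range l, q ^ (A + t) = q ^ (A * l + (l.choose 2 : ℤ)) := by
  induction l with
  | zero => simp
  | succ l ih =>
    rw [Finset.prod_range_succ, ih, ← zpow_add₀ hq0, Nat.choose_succ_succ' l 1,
      Nat.choose_one_right]
    congr 1; push_cast; ring

/-- The limiting case `ρ₁, ρ₂ → ∞` of the Bailey lemma, for a single kernel. -/
theorem hasSum_baileyKernel (hq0 : q ≠ 0) (hq : ‖q‖ < 1) (m k n : ℤ) :
    HasSum (fun j : ℤ => q ^ (j ^ 2 + m * j) * (qFacInv q (n - j) * baileyKernel q m k j))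
      (q ^ (k ^ 2 + m * k) * baileyKernel q m k n) := by
  rcases lt_or_ge n k with hnk | hnk
  · rw [baileyKernel, qFacInv_neg hq0 (by omega : n - k < 0)]
    simp only [zero_mul, mul_zero]
    convert hasSum_zero using 2 with j
    rcases lt_or_ge n j with hj | hj
    · rw [qFacInv_neg hq0 (by omega : n - j < 0)]; simp
    · rw [baileyKernel, qFacInv_neg hq0 (by omega : j - k < 0)]; simp
  · obtain ⟨N, rfl⟩ : ∃ N : ℕ, n = k + N := ⟨(n - k).toNat, by omega⟩
    convert hasSum_int_of_support k N ?_ ?_ using 1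
    -- Substituting j = k + l turns the sum into Vandermonde with M = m + 2k; z = 0 leaves a pure
    -- power of q.
    · have hV := sum_qFacInv_vandermonde hq0 hq N (m + 2 * k) 0
      simp only [zero_mul, sub_zero, Finset.prod_const_one, one_mul] at hV
      have e1 : baileyKernel q m k (k + N) = qFacInv q N * qFacInv q (N + (m + 2 * k)) := by
        rw [baileyKernel]; congr 2 <;> ring
      rw [e1, ← hV, Finset.mul_sum]
      refine Finset.sum_congr rfl fun l _ => ?_
      have e2 : ∏ t ∈ Finset.range l, (0 - q ^ (m + 2 * k + 1 + t))
          = (-1) ^ l * q ^ ((m + 2 * k + 1) * l + (l.choose 2 : ℤ)) := by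
        simp only [zero_sub]
        rw [← prod_zpow_add_natCast hq0, Finset.prod_neg, Finset.card_range]
      have e3 : q ^ ((k + l : ℤ) ^ 2 + m * (k + l)) = q ^ (k ^ 2 + m * k) *
          (q ^ (l.choose 2) * q ^ ((m + 2 * k + 1) * l + (l.choose 2 : ℤ))) := by
        rw [← zpow_natCast q (l.choose 2), ← zpow_add₀ hq0, ← zpow_add₀ hq0]
        congr 1
        linear_combination -two_mul_choose_two l
      have e4 : ((-1 : ℂ) ^ l) * (-1) ^ l = 1 := by rw [← mul_pow]; simp
      rw [e2, e3, baileyKernel, show k + (N : ℤ) - (k + l) = N - l by ring,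
        show k + (l : ℤ) - k = l by ring, show k + (l : ℤ) + m + k = l + (m + 2 * k) by ring]
      linear_combination (q ^ (k ^ 2 + m * k) *
          (q ^ (l.choose 2) * q ^ ((m + 2 * k + 1) * l + (l.choose 2 : ℤ)))
          * (qFacInv q (N - l) * qFacInv q l * qFacInv q (l + (m + 2 * k)))) * e4
    · intro j hj
      rw [baileyKernel, qFacInv_neg hq0 (by omega : j - k < 0)]; simp
    · intro j hj
      rw [qFacInv_neg hq0 (by omega : k + N - j < 0)]; simp

/-- The step of the Bailey lattice that lowers the exponent by `j`, for a single kernel. -/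
theorem hasSum_baileyKernel_lowered (hq0 : q ≠ 0) (hq : ‖q‖ < 1) (m k n : ℤ) :
    HasSum (fun j : ℤ => q ^ (j ^ 2 + (m - 1) * j) *
        (qFacInv q (n - j) * baileyKernel q m k j))
      (q ^ (k ^ 2 + (m - 1) * k) * (baileyKernel q m k n
        + q ^ (m + 2 * k) * baileyKernel q (m - 1) (k + 1) n)) := by
  have h1 := (hasSum_baileyKernel hq0 hq m k n).mul_left (q ^ (-k))
  have h2 := hasSum_baileyKernel hq0 hq (m - 1) (k + 1) n
  have e : q ^ (k ^ 2 + (m - 1) * k) * (baileyKernel q m k n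
        + q ^ (m + 2 * k) * baileyKernel q (m - 1) (k + 1) n)
      = q ^ (-k) * (q ^ (k ^ 2 + m * k) * baileyKernel q m k n)
        + q ^ ((k + 1) ^ 2 + (m - 1) * (k + 1)) * baileyKernel q (m - 1) (k + 1) n := by
    rw [mul_add, ← mul_assoc, ← mul_assoc, ← zpow_add₀ hq0, ← zpow_add₀ hq0]
    congr 3 <;> ring
  rw [e]
  refine Eq.subst (motive := fun f => HasSum f _) (funext fun j => Eq.symm ?_) (h1.add h2)
  have hF := one_sub_zpow_mul_qFacInv hq0 hq (j - k)
  simp only [baileyKernel]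
  rw [show j - (k + 1) = j - k - 1 by ring, show j + (m - 1) + (k + 1) = j + m + k by ring,
    ← hF, show j ^ 2 + m * j = j ^ 2 + (m - 1) * j + j by ring, zpow_add₀ hq0 _ j,
    zpow_sub₀ hq0, zpow_neg]
  have := zpow_ne_zero k hq0
  field_simp
  ring

/-- The effect of one more lowered step on a kernel that has undergone `i` of them. -/
theorem hasSum_baileyKernel_lowered_iterate (hq0 : q ≠ 0) (hq : ‖q‖ < 1) (m k n : ℤ) (i : ℕ) :
    HasSum (fun j : ℤ => q ^ (j ^ 2 + (m - 1) * j) * (qFacInv q (n - j) *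
        (baileyKernel q m k j + (∑ l ∈ Finset.range i, (q ^ (m + 2 * k)) ^ (l + 1)) *
          baileyKernel q (m - 1) (k + 1) j)))
      (q ^ (k ^ 2 + (m - 1) * k) * (baileyKernel q m k n
        + (∑ l ∈ Finset.range (i + 1), (q ^ (m + 2 * k)) ^ (l + 1)) *
          baileyKernel q (m - 1) (k + 1) n)) := by
  have h1 := hasSum_baileyKernel_lowered hq0 hq m k n
  have h2 := (hasSum_baileyKernel hq0 hq (m - 1) (k + 1) n).mul_left
    (∑ l ∈ Finset.range i, (q ^ (m + 2 * k)) ^ (l + 1))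
  -- The lowered weight is the plain weight for K_{m-1,k+1}, with scalar y times that of K_{m,k},
  -- where y = q^{m+2k}. So a step maps the coefficient S to y + yS.
  have hs : ∑ l ∈ Finset.range (i + 1), (q ^ (m + 2 * k)) ^ (l + 1)
      = q ^ (m + 2 * k) + q ^ (m + 2 * k) * ∑ l ∈ Finset.range i, (q ^ (m + 2 * k)) ^ (l + 1) := by
    rw [Finset.sum_range_succ', Finset.mul_sum, add_comm]
    congr 1
    · ring
    · exact Finset.sum_congr rfl fun l _ => by ring
  have e : q ^ ((k + 1) ^ 2 + (m - 1) * (k + 1))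
      = q ^ (k ^ 2 + (m - 1) * k) * q ^ (m + 2 * k) := by
    rw [← zpow_add₀ hq0]; congr 1; ring
  convert h1.add h2 using 1
  · funext j; ring
  · rw [hs, e]; ring

end bailey

/-! ### The summation with the extra factor (-q^{(m+1)/2})_j. -/

section finitePoch

variable {p q : ℂ}

theorem norm_zpow_lt_one (hp1 : ‖p‖ < 1) {e : ℤ} (he : 0 < e) : ‖p ^ e‖ < 1 := by
  lift e to ℕ using he.le
  rw [zpow_natCast, norm_pow]
  exact pow_lt_one₀ (norm_nonneg _) hp1 (by omega)

theorem qPoch_add_natCast (hq0 : q ≠ 0) (hq : ‖q‖ < 1) {a : ℂ} {k : ℤ}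
    (ha : qPochInf (a * q ^ k) q ≠ 0) (l : ℕ) :
    qPoch a q (k + l) = qPoch a q k * ∏ t ∈ Finset.range l, (1 - a * q ^ k * q ^ t) := by
  have h := qPochInf_eq_prod_mul hq (a * q ^ k) l
  have h2 : a * q ^ (k + l) = a * q ^ k * q ^ l := by
    rw [zpow_add₀ hq0, zpow_natCast]; ring
  rw [qPoch, qPoch, h2]
  rw [h] at ha
  rw [h]
  have h3 := left_ne_zero_of_mul ha
  have h4 := right_ne_zero_of_mul ha
  field_simp

/-- The `q`-shifted factorial `(-p^{m+1}; q)_j`, cut off at `j ≥ -⌊m/2⌋`. -/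
noncomputable def cutPoch (p q : ℂ) (m : ℕ) (j : ℤ) : ℂ :=
  if -((m / 2 : ℕ) : ℤ) ≤ j then qPoch (-p ^ (m + 1)) q j else 0

theorem neg_pow_mul_zpow (hp0 : p ≠ 0) (hp : p ^ 2 = q) (m : ℕ) (j : ℤ) :
    -p ^ (m + 1) * q ^ j = -p ^ ((m : ℤ) + 1 + 2 * j) := by
  rw [← hp, ← zpow_natCast, ← zpow_natCast, ← zpow_mul, zpow_add₀ hp0, neg_mul]
  push_cast
  rfl

/-- The cutoff gives m + 1 + 2j ≥ 1, so the argument has modulus below 1. Hence the quotient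
defining `qPoch` has a nonzero denominator on the range of summation. -/
theorem qPochInf_neg_pow_mul_zpow_ne_zero (hp0 : p ≠ 0) (hp1 : ‖p‖ < 1) (hq : ‖q‖ < 1)
    (hp : p ^ 2 = q) (m : ℕ) {j : ℤ} (hj : -((m / 2 : ℕ) : ℤ) ≤ j) :
    qPochInf (-p ^ (m + 1) * q ^ j) q ≠ 0 := by
  rw [neg_pow_mul_zpow hp0 hp]
  refine qPochInf_ne_zero_of_norm_lt_one hq ?_
  rw [norm_neg]
  exact norm_zpow_lt_one hp1 (by omega)

/-- The case `ρ₁ → ∞`, `ρ₂ = -q^{(m+1)/2}` of the Bailey lemma, for a single kernel. -/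
theorem hasSum_cutPoch_baileyKernel_of_nonneg (hp0 : p ≠ 0) (hp1 : ‖p‖ < 1) (hq0 : q ≠ 0)
    (hq : ‖q‖ < 1) (hp : p ^ 2 = q) (m : ℕ) (k n : ℤ) (hk : 0 ≤ m + 2 * k) :
    HasSum (fun j : ℤ => p ^ (j ^ 2 + m * j) * cutPoch p q m j *
        (qFacInv q (n - j) * baileyKernel q m k j))
      (cutPoch p q m n * (p ^ (k ^ 2 + m * k) * baileyKernel q m k n)) := by
  rcases lt_or_ge n k with hnk | hnk
  · rw [baileyKernel, qFacInv_neg hq0 (by omega : n - k < 0)]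
    simp only [zero_mul, mul_zero]
    convert hasSum_zero using 2 with j
    rcases lt_or_ge n j with hj | hj
    · rw [qFacInv_neg hq0 (by omega : n - j < 0)]; simp
    · rw [baileyKernel, qFacInv_neg hq0 (by omega : j - k < 0)]; simp
  · obtain ⟨N, rfl⟩ : ∃ N : ℕ, n = k + N := ⟨(n - k).toNat, by omega⟩
    have hcut : ∀ l : ℕ, cutPoch p q m (k + l) = qPoch (-p ^ (m + 1)) q k *
        ∏ t ∈ Finset.range l, (1 - -p ^ (m + 2 * k + 1) * q ^ t) := by
      intro l
      rw [cutPoch, if_pos (by omega), qPoch_add_natCast hq0 hq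
        (qPochInf_neg_pow_mul_zpow_ne_zero hp0 hp1 hq hp m (by omega)), neg_pow_mul_zpow hp0 hp,
        show (m : ℤ) + 1 + 2 * k = m + 2 * k + 1 by ring]
    convert hasSum_int_of_support k N ?_ ?_ using 1
    · have hV := sum_qFacInv_vandermonde hq0 hq N (m + 2 * k) (-p ^ (m + 2 * k + 1))
      have e1 : baileyKernel q m k (k + N) = qFacInv q N * qFacInv q (N + (m + 2 * k)) := by
        rw [baileyKernel]; congr 2 <;> ring
      have e0 : cutPoch p q m (k + N) * (p ^ (k ^ 2 + m * k) * baileyKernel q m k (k + N))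
          = qPoch (-p ^ (m + 1)) q k * p ^ (k ^ 2 + m * k) *
            ((∏ t ∈ Finset.range N, (1 - -p ^ (m + 2 * k + 1) * q ^ t)) *
              (qFacInv q N * qFacInv q (N + (m + 2 * k)))) := by
        rw [e1, hcut]; ring
      rw [e0, ← hV, Finset.mul_sum]
      refine Finset.sum_congr rfl fun l _ => ?_
      -- With z = -p^{m+2k+1} one has z² = q^{m+2k+1}, so z - q^{m+2k+1+t} = z(1 - z q^t): the
      -- Vandermonde product becomes the shifted factorial itself.
      have e2 : ∏ t ∈ Finset.range l, (-p ^ (m + 2 * k + 1) - q ^ (m + 2 * k + 1 + t))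
          = (-1) ^ l * p ^ ((m + 2 * k + 1) * l) *
            ∏ t ∈ Finset.range l, (1 - -p ^ (m + 2 * k + 1) * q ^ t) := by
        have hpow : (-1) ^ l * p ^ ((m + 2 * k + 1) * l)
            = ∏ _t ∈ Finset.range l, -p ^ (m + 2 * k + 1) := by
          rw [Finset.prod_const, Finset.card_range, neg_pow (p ^ _), zpow_mul, zpow_natCast]
        rw [hpow, ← Finset.prod_mul_distrib]
        refine Finset.prod_congr rfl fun t _ => ?_
        have : q ^ (m + 2 * k + 1) = p ^ (m + 2 * k + 1) * p ^ (m + 2 * k + 1) := by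
          rw [← hp, ← mul_zpow, sq]
        rw [zpow_add₀ hq0, this, zpow_natCast]
        ring
      have e3 : p ^ ((k + l : ℤ) ^ 2 + m * (k + l)) = p ^ (k ^ 2 + m * k) *
          (q ^ (l.choose 2) * p ^ ((m + 2 * k + 1) * l)) := by
        rw [← hp, ← pow_mul, ← zpow_natCast p, ← zpow_add₀ hp0, ← zpow_add₀ hp0]
        congr 1
        push_cast
        linear_combination -two_mul_choose_two l
      have e4 : ((-1 : ℂ) ^ l) * (-1) ^ l = 1 := by rw [← mul_pow]; simp
      rw [e2, e3, hcut, baileyKernel, show k + (N : ℤ) - (k + l) = N - l by ring,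
        show k + (l : ℤ) - k = l by ring, show k + (l : ℤ) + m + k = l + (m + 2 * k) by ring]
      generalize ∏ t ∈ Finset.range l, (1 - -p ^ (m + 2 * k + 1) * q ^ t) = X
      linear_combination (qPoch (-p ^ (m + 1)) q k * X * p ^ (k ^ 2 + m * k) *
          (q ^ (l.choose 2) * p ^ ((m + 2 * k + 1) * l))
          * (qFacInv q (N - l) * qFacInv q l * qFacInv q (l + (m + 2 * k)))) * e4
    · intro j hj
      rw [baileyKernel, qFacInv_neg hq0 (by omega : j - k < 0)]; simp
    · intro j hj
      rw [qFacInv_neg hq0 (by omega : k + N - j < 0)]; simp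

/-- If m + 2k < 0, the reflection k ↦ -m-k fixes both the kernel and k² + mk and reverses the sign
of m + 2k. -/
theorem hasSum_cutPoch_baileyKernel (hp0 : p ≠ 0) (hp1 : ‖p‖ < 1) (hq0 : q ≠ 0)
    (hq : ‖q‖ < 1) (hp : p ^ 2 = q) (m : ℕ) (k n : ℤ) :
    HasSum (fun j : ℤ => p ^ (j ^ 2 + m * j) * cutPoch p q m j *
        (qFacInv q (n - j) * baileyKernel q m k j))
      (cutPoch p q m n * (p ^ (k ^ 2 + m * k) * baileyKernel q m k n)) := by
  rcases le_or_gt 0 (m + 2 * k) with hk | hk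
  · exact hasSum_cutPoch_baileyKernel_of_nonneg hp0 hp1 hq0 hq hp m k n hk
  · have h := hasSum_cutPoch_baileyKernel_of_nonneg hp0 hp1 hq0 hq hp m (-m - k) n (by linarith)
    simp only [baileyKernel_symm] at h
    rwa [show (-(m : ℤ) - k) ^ 2 + m * (-m - k) = k ^ 2 + m * k by ring] at h

end finitePoch

/-! ### The initial Bailey pair. -/

section basePair

variable {p q : ℂ}

/-- The `q`-binomial theorem as a bilateral sum over kernels. -/
theorem hasSum_theta_baileyKernel (hp0 : p ≠ 0) (hq0 : q ≠ 0) (hq : ‖q‖ < 1) (hp : p ^ 2 = q)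
    {x : ℂ} (hx : x ≠ 0) (m n : ℤ) (N : ℕ) (hN : 2 * n + m = N) :
    HasSum (fun k : ℤ => (-x) ^ k * p ^ (k * (k - 1)) * baileyKernel q m k n)
      ((-x) ^ (-(n + m)) * p ^ ((n + m) * (n + m + 1)) *
        ((∏ t ∈ Finset.range N, (1 - x * q ^ ((t : ℤ) - (n + m)))) * qFacInv q N)) := by
  have hx' : -x ≠ 0 := neg_ne_zero.2 hx
  convert hasSum_int_of_support (-(n + m)) N ?_ ?_ using 1
  · have hB := sum_qFacInv_binomial hq0 hq N (x * q ^ (-(n + m)))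
    have e : ∀ t : ℕ, x * q ^ (-(n + m)) * q ^ t = x * q ^ ((t : ℤ) - (n + m)) := fun t => by
      rw [mul_assoc, ← zpow_natCast, ← zpow_add₀ hq0]; congr 2; ring
    simp only [e] at hB
    rw [← hB, Finset.mul_sum]
    refine Finset.sum_congr rfl fun l _ => ?_
    have e1 : (-x) ^ (-(n + m) + l) = (-x) ^ (-(n + m)) * (-x) ^ l := by
      rw [zpow_add₀ hx', zpow_natCast]
    have e2 : p ^ ((-(n + m) + l) * (-(n + m) + l - 1)) = p ^ ((n + m) * (n + m + 1)) *
        ((q ^ (-(n + m))) ^ l * q ^ (l.choose 2)) := by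
      rw [← hp, ← pow_mul, ← zpow_natCast p, ← zpow_natCast p, ← zpow_natCast (_ ^ (-(n + m))),
        ← zpow_mul, ← zpow_mul, ← zpow_add₀ hp0, ← zpow_add₀ hp0]
      congr 1
      push_cast
      linear_combination -two_mul_choose_two l
    rw [e1, e2, baileyKernel, show n - (-(n + m) + (l : ℤ)) = N - l by rw [← hN]; ring,
      show n + m + (-(n + m) + (l : ℤ)) = l by ring, neg_mul_eq_neg_mul, mul_pow]
    ring
  · intro j hj
    rw [baileyKernel, qFacInv_neg hq0 (by omega : n + m + j < 0)]; simp
  · intro j hj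
    rw [baileyKernel, qFacInv_neg hq0 (by omega : n - j < 0)]; simp

theorem prod_one_sub_zpow_mul_qFacInv (hq0 : q ≠ 0) (hq : ‖q‖ < 1) (a : ℤ) (N : ℕ) :
    (∏ t ∈ Finset.range N, (1 - q ^ (a - t))) * qFacInv q a = qFacInv q (a - N) := by
  induction N with
  | zero => simp
  | succ N ih =>
    rw [Finset.prod_range_succ, mul_right_comm, ih, mul_comm,
      one_sub_zpow_mul_qFacInv hq0 hq]
    congr 1; push_cast; ring

/-- This is the q-binomial theorem at x = 1, where the product telescopes against 1/(q)_{m+n} to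
1/(q)_{-n}. Hence the sum vanishes for n > 0, as the q-binomial coefficient does. -/
theorem hasSum_basePair (hp0 : p ≠ 0) (hq0 : q ≠ 0) (hq : ‖q‖ < 1) (hp : p ^ 2 = q)
    (m : ℕ) (n : ℤ) :
    HasSum (fun k : ℤ => (-1) ^ k * p ^ (k * (k - 1)) * baileyKernel q m k n)
      ((-1) ^ n * p ^ (n * (n - 1)) * qBinom q (m + n) (m + 2 * n)) := by
  rcases lt_or_ge (m + 2 * n) 0 with hneg | hpos
  · rw [qBinom, if_neg (by omega), mul_zero]
    convert hasSum_zero using 2 with k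
    rcases lt_or_ge n k with hk | hk
    · rw [baileyKernel, qFacInv_neg hq0 (by omega : n - k < 0)]; simp
    · rw [baileyKernel, qFacInv_neg hq0 (by omega : n + m + k < 0)]; simp
  · obtain ⟨N, hN⟩ : ∃ N : ℕ, 2 * n + m = N := ⟨(m + 2 * n).toNat, by omega⟩
    convert hasSum_theta_baileyKernel hp0 hq0 hq hp one_ne_zero m n N hN using 1
    have ha : qFacInv q (m + n) ≠ 0 := qFacInv_ne_zero hq (by omega)
    have hb : qBinom q (m + n) (m + 2 * n) * qFacInv q (m + n)
        = qFacInv q N * qFacInv q (-n) := by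
      rw [qBinom]
      split_ifs with h
      · have h1 : qFacInv q (m + 2 * n) ≠ 0 := qFacInv_ne_zero hq h.1
        have h2 : qFacInv q (-n) ≠ 0 := qFacInv_ne_zero hq (by omega)
        rw [qPoch_self_eq, qPoch_self_eq, qPoch_self_eq,
          show (m : ℤ) + n - (m + 2 * n) = -n by ring, ← hN, add_comm (2 * n)]
        field_simp
      · rw [qFacInv_neg hq0 (by omega : -n < 0)]; simp
    have hprod := prod_one_sub_zpow_mul_qFacInv hq0 hq (m + n) N
    rw [show (m : ℤ) + n - N = -n by omega] at hprod
    have hflip : ∏ t ∈ Finset.range N, (1 - (1 : ℂ) * q ^ ((t : ℤ) - (n + m)))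
        = (-1) ^ N * q ^ (-(n + m) * N + (N.choose 2 : ℤ)) *
          ∏ t ∈ Finset.range N, (1 - q ^ ((m : ℤ) + n - t)) := by
      have hpow : (-1) ^ N * q ^ (-(n + m) * N + (N.choose 2 : ℤ))
          = ∏ t ∈ Finset.range N, -q ^ (-(n + m) + (t : ℤ)) := by
        rw [Finset.prod_neg, Finset.card_range, prod_zpow_add_natCast hq0]
      rw [hpow, ← Finset.prod_mul_distrib]
      refine Finset.prod_congr rfl fun t _ => ?_
      have : q ^ (-(n + m) + (t : ℤ)) * q ^ ((m : ℤ) + n - t) = 1 := by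
        rw [← zpow_add₀ hq0]; ring_nf; simp
      rw [show (t : ℤ) - (n + m) = -(n + m) + t by ring]
      linear_combination -this
    refine mul_right_cancel₀ ha ?_
    rw [mul_assoc, hb, hflip, ← hprod]
    have hsign : (-1 : ℂ) ^ n = (-1) ^ (-(n + m)) * (-1) ^ N := by
      rw [← zpow_natCast, ← zpow_add₀ (by norm_num), ← hN]; congr 1; ring
    have hexp : p ^ (n * (n - 1)) = p ^ ((n + m) * (n + m + 1)) *
        q ^ (-(n + m) * N + (N.choose 2 : ℤ)) := by
      rw [← hp, ← zpow_natCast p, ← zpow_mul, ← zpow_add₀ hp0]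
      congr 1
      have := two_mul_choose_two N
      rw [← hN] at this ⊢
      push_cast
      linear_combination -this
    rw [hsign, hexp]
    ring

end basePair

/-! ### Convergence of quadratic exponentials; bounds and limits of the kernel. -/

section summability

theorem summable_pow_mul_self_mul_pow {ρ : ℝ} (hρ0 : 0 ≤ ρ) (hρ : ρ < 1) {y : ℝ} (hy : 0 ≤ y) :
    Summable fun n : ℕ => ρ ^ (n * n) * y ^ n := by
  refine Summable.of_norm_bounded_eventually_nat
    (summable_geometric_of_lt_one (r := (1 / 2 : ℝ)) (by norm_num) (by norm_num)) ?_
  have h : Tendsto (fun n : ℕ => ρ ^ n * y) atTop (𝓝 (0 * y)) :=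
    (tendsto_pow_atTop_nhds_zero_of_lt_one hρ0 hρ).mul_const y
  rw [zero_mul] at h
  filter_upwards [h.eventually_lt_const (by norm_num : (0 : ℝ) < 1 / 2)] with n hn
  rw [pow_mul, ← mul_pow, norm_pow, Real.norm_of_nonneg (by positivity)]
  gcongr

theorem summable_zpow_mul_self_mul_zpow {ρ : ℝ} (hρ0 : 0 ≤ ρ) (hρ : ρ < 1) {y : ℝ}
    (hy : 0 ≤ y) : Summable fun k : ℤ => ρ ^ (k * k) * y ^ k := by
  refine Summable.of_nat_of_neg ?_ ?_
  · refine (summable_pow_mul_self_mul_pow hρ0 hρ hy).congr fun n => ?_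
    rw [← Nat.cast_mul, zpow_natCast, zpow_natCast]
  · refine (summable_pow_mul_self_mul_pow hρ0 hρ (inv_nonneg.2 hy)).congr fun n => ?_
    rw [neg_mul_neg, ← Nat.cast_mul, zpow_natCast, zpow_neg, zpow_natCast, inv_pow]

theorem summable_norm_zpow_quadratic {p : ℂ} (hp0 : p ≠ 0) (hp1 : ‖p‖ < 1) {a : ℤ} (ha : 0 < a)
    (b : ℤ) : Summable fun k : ℤ => ‖p ^ (a * k ^ 2 + b * k)‖ := by
  refine (summable_zpow_mul_self_mul_zpow (norm_nonneg (p ^ a)) (norm_zpow_lt_one hp1 ha)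
    (norm_nonneg (p ^ b))).congr fun k => ?_
  rw [← norm_zpow, ← norm_zpow, ← norm_mul, ← zpow_mul, ← zpow_mul, ← zpow_add₀ hp0]
  congr 3; ring

theorem exists_bound_baileyKernel {q : ℂ} (hq0 : q ≠ 0) (hq : ‖q‖ < 1) :
    ∃ C, 0 ≤ C ∧ ∀ m k n, ‖baileyKernel q m k n‖ ≤ C := by
  obtain ⟨C, hC0, hC⟩ := exists_bound_qFacInv hq0 hq
  refine ⟨C * C, by positivity, fun m k n => ?_⟩
  rw [baileyKernel, norm_mul]
  exact mul_le_mul (hC _) (hC _) (norm_nonneg _) hC0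

theorem tendsto_baileyKernel {q : ℂ} (hq : ‖q‖ < 1) (m k : ℤ) :
    Tendsto (baileyKernel q m k) atTop (𝓝 ((qPochInf q q)⁻¹ * (qPochInf q q)⁻¹)) := by
  have h := tendsto_qFacInv hq
  refine (h.comp (tendsto_atTop_add_const_right atTop (-k) tendsto_id)).mul
    (h.comp (tendsto_atTop_add_const_right atTop (m + k) tendsto_id)) |>.congr fun n => ?_
  simp only [Function.comp, id, baileyKernel]
  congr 2; ring

end summability

/-! ### The Jacobi triple product, as the n → ∞ limit of the kernel sum. -/

section tripleProduct

variable {p q : ℂ}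

/-- Each factor is 1 - x q^{-s} = -x q^{-s} (1 - q^s/x) for s = 1, …, N; the prefactor cancels the
product of the -x q^{-s}. -/
theorem prod_theta_shift (hp0 : p ≠ 0) (hq0 : q ≠ 0) (hp : p ^ 2 = q) {x : ℂ} (hx : x ≠ 0)
    (N : ℕ) :
    (-x) ^ (-(N : ℤ)) * p ^ ((N : ℤ) * (N + 1)) *
        ∏ t ∈ Finset.range N, (1 - x * q ^ ((t : ℤ) - N))
      = ∏ t ∈ Finset.range N, (1 - q / x * q ^ t) := by
  induction N with
  | zero => simp
  | succ N ih =>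
    have hx' : -x ≠ 0 := neg_ne_zero.2 hx
    rw [Finset.prod_range_succ', Finset.prod_range_succ _ N, ← ih]
    have e1 : ∀ t : ℕ, (((t + 1 : ℕ) : ℤ) - ((N + 1 : ℕ) : ℤ)) = t - N := fun t => by
      push_cast; ring
    have e2 : p ^ (((N + 1 : ℕ) : ℤ) * (((N + 1 : ℕ) : ℤ) + 1))
        = p ^ ((N : ℤ) * (N + 1)) * q ^ ((N : ℤ) + 1) := by
      rw [← hp, ← zpow_natCast p, ← zpow_mul, ← zpow_add₀ hp0]
      congr 1; push_cast; ring
    have e3 : (-x) ^ (-((N + 1 : ℕ) : ℤ)) = (-x) ^ (-(N : ℤ)) * (-x)⁻¹ := by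
      rw [← zpow_neg_one, ← zpow_add₀ hx']
      congr 1; push_cast; ring
    have e4 : q ^ (((0 : ℕ) : ℤ) - ((N + 1 : ℕ) : ℤ)) = (q ^ ((N : ℤ) + 1))⁻¹ := by
      rw [← zpow_neg]; congr 1
    have e5 : q / x * q ^ N = q ^ ((N : ℤ) + 1) / x := by
      rw [zpow_add_one₀ hq0, zpow_natCast]; ring
    simp only [e1]
    rw [e2, e3, e4, e5]
    have := zpow_ne_zero ((N : ℤ) + 1) hq0
    generalize ∏ t ∈ Finset.range N, (1 - x * q ^ ((t : ℤ) - N)) = X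
    generalize q ^ ((N : ℤ) + 1) = Y at *
    field_simp
    ring

theorem summable_norm_theta (hp0 : p ≠ 0) (hp1 : ‖p‖ < 1) (x : ℂ) :
    Summable fun k : ℤ => ‖(-x) ^ k * p ^ (k * (k - 1))‖ := by
  refine (summable_zpow_mul_self_mul_zpow (norm_nonneg p) hp1
    (norm_nonneg (-x * p⁻¹))).congr fun k => ?_
  rw [← norm_zpow, ← norm_zpow, ← norm_mul, mul_zpow, mul_sub, mul_one, zpow_sub₀ hp0, inv_zpow]
  congr 1; ring

/-- The Jacobi triple product identity. -/
theorem hasSum_jacobi_triple_product (hp0 : p ≠ 0) (hp1 : ‖p‖ < 1) (hq0 : q ≠ 0) (hq : ‖q‖ < 1)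
    (hp : p ^ 2 = q) {x : ℂ} (hx : x ≠ 0) :
    HasSum (fun k : ℤ => (-x) ^ k * p ^ (k * (k - 1))) (qPochInf₃ q x (q / x) q) := by
  obtain ⟨C, hC0, hC⟩ := exists_bound_baileyKernel hq0 hq
  have hQ := qPochInf_self_ne_zero hq
  have hsum := summable_norm_theta hp0 hp1 x
  have hlim := tendsto_tsum_of_dominated_convergence (𝓕 := atTop)
    (f := fun (n : ℕ) (k : ℤ) => (-x) ^ k * p ^ (k * (k - 1)) * baileyKernel q 0 k n)
    (g := fun k => (-x) ^ k * p ^ (k * (k - 1)) * ((qPochInf q q)⁻¹ * (qPochInf q q)⁻¹))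
    (hsum.mul_right C)
    (fun k => ((tendsto_baileyKernel hq 0 k).comp tendsto_natCast_atTop_atTop).const_mul _)
    (Eventually.of_forall fun n k => by
      rw [norm_mul]; exact mul_le_mul_of_nonneg_left (hC _ _ _) (norm_nonneg _))
  have hval : ∀ n : ℕ, ∑' k : ℤ, (-x) ^ k * p ^ (k * (k - 1)) * baileyKernel q 0 k n
      = (∏ t ∈ Finset.range n, (1 - q / x * q ^ t)) * (∏ t ∈ Finset.range n, (1 - x * q ^ t))
        * qFacInv q ((2 * n : ℕ) : ℤ) := by
    intro n
    have h := hasSum_theta_baileyKernel hp0 hq0 hq hp hx 0 n (2 * n) (by push_cast; ring)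
    -- The 2n factors split into n with negative powers of q, giving the q/x product, and n with
    -- nonnegative powers, giving the x product.
    rw [h.tsum_eq, two_mul, Finset.prod_range_add, ← prod_theta_shift hp0 hq0 hp hx]
    have e : ∀ t : ℕ, x * q ^ (((n + t : ℕ) : ℤ) - n) = x * q ^ t := fun t => by
      rw [← zpow_natCast]; congr 2; push_cast; ring
    simp only [add_zero, e]
    ring
  have h2n : Tendsto (fun n : ℕ => ((2 * n : ℕ) : ℤ)) atTop atTop :=
    tendsto_natCast_atTop_atTop.comp (tendsto_id.const_mul_atTop' (by norm_num))
  have hlim2 := ((tendsto_prod_qPochInf hq (q / x)).mul (tendsto_prod_qPochInf hq x)).mul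
    ((tendsto_qFacInv hq).comp h2n)
  have huniq := tendsto_nhds_unique hlim (hlim2.congr fun n => (hval n).symm)
  rw [tsum_mul_right] at huniq
  have : ∑' k : ℤ, (-x) ^ k * p ^ (k * (k - 1)) = qPochInf₃ q x (q / x) q := by
    rw [qPochInf₃]
    field_simp at huniq
    linear_combination huniq
  rw [← this]
  exact hsum.of_norm.hasSum

end tripleProduct

/-! ### Multisums over chains, summed one variable at a time. -/

section chain

/-- The summand of a multisum over chains `(s_0, …, s_N)` with links `K (s_j - s_{j+1})`,
weights `w j (s_j)` and a final factor `β (s_N)`. -/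
noncomputable def chainTerm (K : ℤ → ℂ) (N : ℕ) (w : ℕ → ℤ → ℂ) (β : ℤ → ℂ)
    (s : Fin (N + 1) → ℤ) : ℂ :=
  (∏ j : Fin (N + 1), w j (s j)) * (∏ j : Fin N, K (s j.castSucc - s j.succ)) * β (s (Fin.last N))

theorem summable_norm_prod_pi (w : ℕ → ℤ → ℂ) (N : ℕ)
    (hw : ∀ j < N, Summable fun x => ‖w j x‖) :
    Summable fun s : Fin N → ℤ => ‖∏ j : Fin N, w j (s j)‖ := by
  induction N with
  | zero => exact Summable.of_finite
  | succ N ih =>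
    rw [← (Fin.snocEquiv fun _ : Fin (N + 1) => ℤ).summable_iff]
    refine ((hw N (by omega)).mul_norm (ih fun j hj => hw j (by omega))).congr fun x => ?_
    simp [Fin.prod_univ_castSucc, Fin.snocEquiv, mul_comm]

variable {K : ℤ → ℂ} {N : ℕ} {w : ℕ → ℤ → ℂ} {β : ℤ → ℂ} {C B : ℝ}

/-- All decay comes from the weights; links and final factor need only be bounded. -/
theorem summable_norm_chainTerm (hK : ∀ k, ‖K k‖ ≤ C)
    (hw : ∀ j ≤ N, Summable fun x => ‖w j x‖) (hβ : ∀ k, ‖β k‖ ≤ B) :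
    Summable fun s => ‖chainTerm K N w β s‖ := by
  refine Summable.of_nonneg_of_le (fun _ => norm_nonneg _) (fun s => ?_)
    ((summable_norm_prod_pi w (N + 1) fun j hj => hw j (by omega)).mul_right (C ^ N * B))
  have hC : 0 ≤ C := (norm_nonneg _).trans (hK 0)
  rw [chainTerm, mul_assoc, norm_mul, norm_mul]
  gcongr
  · rw [norm_prod]
    calc _ ≤ ∏ _j : Fin N, C := Finset.prod_le_prod (fun _ _ => norm_nonneg _) fun _ _ => hK _
      _ = C ^ N := by simp
  · exact hβ _

/-- Summation over the innermost variable of a chain. -/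
theorem tsum_chainTerm_succ (hK : ∀ k, ‖K k‖ ≤ C)
    (hw : ∀ j ≤ N + 1, Summable fun x => ‖w j x‖) (hβ : ∀ k, ‖β k‖ ≤ B) :
    ∑' s, chainTerm K (N + 1) w β s
      = ∑' s, chainTerm K N w (fun y => ∑' x, w (N + 1) x * (K (y - x) * β x)) s := by
  have hs := (summable_norm_chainTerm hK hw hβ).of_norm
  let e := (Equiv.prodComm _ _).trans (Fin.snocEquiv fun _ : Fin (N + 2) => ℤ)
  rw [← e.summable_iff] at hs
  rw [← e.tsum_eq]
  refine (Summable.tsum_prod hs).trans ?_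
  refine tsum_congr fun s => ?_
  rw [chainTerm.eq_def K N, ← tsum_mul_left]
  refine tsum_congr fun x => ?_
  change chainTerm K (N + 1) w β (Fin.snoc (α := fun _ => ℤ) s x) = _
  rw [chainTerm, Fin.prod_univ_castSucc (n := N + 1), Fin.prod_univ_castSucc (n := N)
    (f := fun j => K (Fin.snoc (α := fun _ => ℤ) s x j.castSucc
      - Fin.snoc (α := fun _ => ℤ) s x j.succ))]
  simp only [Fin.snoc_castSucc, Fin.snoc_last, Fin.val_castSucc, Fin.val_last,
    Fin.succ_castSucc, Fin.succ_last]
  ring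

theorem tsum_chainTerm_zero :
    ∑' s, chainTerm K 0 w β s = ∑' x, w 0 x * β x := by
  rw [← (Equiv.funUnique (Fin 1) ℤ).symm.tsum_eq]
  refine tsum_congr fun x => ?_
  simp [chainTerm]

end chain

/-! ### Interchange of sums and iteration of the Bailey lattice. -/

theorem HasSum.of_eq {f g : ℤ → ℂ} {a b : ℂ} (h : HasSum g a) (hf : ∀ x, f x = g x)
    (hab : b = a) : HasSum f b := by
  rw [hab, funext hf]
  exact h

/-- This lifts a summation for single kernels to a whole Bailey pair: the double series is dominated
by a product of summable functions of x and k. -/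
theorem tsum_mul_tsum_comm {u κ : ℤ → ℂ} (hu : Summable fun x => ‖u x‖) {C : ℝ}
    (hκ : ∀ x, ‖κ x‖ ≤ C) {G : ℤ → ℤ → ℂ} {g : ℤ → ℝ} (hg : Summable g)
    (hG : ∀ k x, ‖G k x‖ ≤ g k) {V : ℤ → ℂ}
    (hV : ∀ k, HasSum (fun x => u x * (κ x * G k x)) (V k)) :
    ∑' x, u x * (κ x * ∑' k, G k x) = ∑' k, V k := by
  have hC : 0 ≤ C := (norm_nonneg _).trans (hκ 0)
  have hg0 : ∀ k, 0 ≤ g k := fun k => (norm_nonneg _).trans (hG k 0)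
  have hs : Summable (Function.uncurry fun x k => u x * (κ x * G k x)) := by
    refine Summable.of_norm_bounded (g := fun z : ℤ × ℤ => ‖u z.1‖ * (C * g z.2))
      (hu.mul_of_nonneg (hg.mul_left C) (fun _ => norm_nonneg _)
        fun k => mul_nonneg hC (hg0 k)) fun z => ?_
    simp only [Function.uncurry, norm_mul]
    gcongr
    · exact hκ _
    · exact hG _ _
  rw [← tsum_congr fun k => (hV k).tsum_eq]
  refine Eq.trans (tsum_congr fun x => ?_) hs.tsum_comm.symm
  rw [tsum_mul_left, tsum_mul_left]

theorem exists_norm_tsum_le {G : ℤ → ℤ → ℂ} {g : ℤ → ℝ} (hg : Summable g)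
    (hG : ∀ k x, ‖G k x‖ ≤ g k) : ∀ x, ‖∑' k, G k x‖ ≤ ∑' k, g k :=
  fun x => tsum_of_norm_bounded hg.hasSum fun k => hG k x

/-- The geometric sum `y + y^2 + ⋯ + y^c` for `y = q^{m+2k}`. -/
noncomputable def geomTail (q : ℂ) (m : ℤ) (c : ℕ) (k : ℤ) : ℂ :=
  ∑ l ∈ Finset.range c, (q ^ (m + 2 * k)) ^ (l + 1)

/-- The `k`-th term of the sequence obtained from a Bailey pair after `c` lowered steps. -/
noncomputable def latticeTerm (q : ℂ) (m : ℤ) (c : ℕ) (α : ℤ → ℂ) (k n : ℤ) : ℂ :=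
  α k * (baileyKernel q m k n + geomTail q m c k * baileyKernel q (m - 1) (k + 1) n)

/-- The sequence obtained from a Bailey pair after `c` lowered steps. -/
noncomputable def latticeSum (q : ℂ) (m : ℤ) (c : ℕ) (α : ℤ → ℂ) (n : ℤ) : ℂ :=
  ∑' k, latticeTerm q m c α k n

/-- The coefficients `(-1)^k p^{ak²+bk}`. -/
noncomputable def thetaCoeff (p : ℂ) (a b k : ℤ) : ℂ := (-1) ^ k * p ^ (a * k ^ 2 + b * k)

/-- The weights of the multisum: `q^{x²+mx}`, lowered by `x` for the first `i` variables. -/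
noncomputable def latticeWeight (q : ℂ) (m : ℤ) (i j : ℕ) (x : ℤ) : ℂ :=
  q ^ (x ^ 2 + (m - if j < i then 1 else 0) * x)

section lattice

variable {p q : ℂ}

theorem norm_thetaCoeff (p : ℂ) (a b k : ℤ) :
    ‖thetaCoeff p a b k‖ = ‖p ^ (a * k ^ 2 + b * k)‖ := by
  rw [thetaCoeff, norm_mul, norm_zpow]; simp

theorem summable_norm_latticeWeight (hq0 : q ≠ 0) (hq : ‖q‖ < 1) (m : ℤ) (i j : ℕ) :
    Summable fun x => ‖latticeWeight q m i j x‖ := by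
  simpa [latticeWeight] using
    summable_norm_zpow_quadratic hq0 hq one_pos (m - if j < i then 1 else 0)

theorem thetaCoeff_mul_latticeWeight (hp0 : p ≠ 0) (hp : p ^ 2 = q) (a b m : ℤ) (i j : ℕ) (k : ℤ) :
    latticeWeight q m i j k * thetaCoeff p a b k
      = thetaCoeff p (a + 2) (b + 2 * (m - if j < i then 1 else 0)) k := by
  rw [thetaCoeff, thetaCoeff, latticeWeight, ← hp, ← zpow_natCast p, ← zpow_mul,
    mul_left_comm, ← zpow_add₀ hp0]
  congr 2
  push_cast
  ring

theorem thetaCoeff_mul_geom (hp0 : p ≠ 0) (hp : p ^ 2 = q) (a b m : ℤ) (l : ℕ) (k : ℤ) :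
    thetaCoeff p a b k * (q ^ (m + 2 * k)) ^ l
      = q ^ (m * l) * thetaCoeff p a (b + 4 * l) k := by
  rw [thetaCoeff, thetaCoeff, ← hp, ← zpow_natCast p, ← zpow_natCast (_ ^ (m + 2 * k)),
    ← zpow_mul, ← zpow_mul, ← zpow_mul, mul_left_comm (p ^ (_ * (m * (l : ℤ)))), mul_assoc,
    ← zpow_add₀ hp0, ← zpow_add₀ hp0]
  congr 2
  push_cast
  ring

/-- `geomTail` may grow as k → -∞, so its powers are absorbed into the theta coefficient before
taking norms; only the linear exponent changes. -/
theorem exists_summable_bound_latticeTerm (hp0 : p ≠ 0) (hp1 : ‖p‖ < 1) (hq0 : q ≠ 0)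
    (hq : ‖q‖ < 1) (hp : p ^ 2 = q) {a : ℤ} (ha : 0 < a) (b m : ℤ) (c : ℕ) :
    ∃ g : ℤ → ℝ, Summable g ∧ ∀ k n, ‖latticeTerm q m c (thetaCoeff p a b) k n‖ ≤ g k := by
  obtain ⟨C, hC0, hC⟩ := exists_bound_baileyKernel hq0 hq
  have hs : ∀ b, Summable fun k => ‖thetaCoeff p a b k‖ := fun b => by
    simpa only [norm_thetaCoeff] using summable_norm_zpow_quadratic hp0 hp1 ha b
  refine ⟨fun k => ‖thetaCoeff p a b k‖ * C + ∑ l ∈ Finset.range c,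
      ‖q ^ (m * (l + 1 : ℕ))‖ * ‖thetaCoeff p a (b + 4 * (l + 1 : ℕ)) k‖ * C,
    ((hs b).mul_right C).add (summable_sum fun l _ => ((hs _).mul_left _).mul_right C),
    fun k n => ?_⟩
  rw [latticeTerm, mul_add]
  refine (norm_add_le _ _).trans (add_le_add ?_ ?_)
  · rw [norm_mul]; gcongr; exact hC _ _ _
  · rw [geomTail, Finset.sum_mul, Finset.mul_sum]
    refine (norm_sum_le _ _).trans (Finset.sum_le_sum fun l _ => ?_)
    rw [← mul_assoc, thetaCoeff_mul_geom hp0 hp, norm_mul, norm_mul]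
    gcongr; exact hC _ _ _

theorem exists_bound_latticeSum (hp0 : p ≠ 0) (hp1 : ‖p‖ < 1) (hq0 : q ≠ 0)
    (hq : ‖q‖ < 1) (hp : p ^ 2 = q) {a : ℤ} (ha : 0 < a) (b m : ℤ) (c : ℕ) :
    ∃ B, ∀ n, ‖latticeSum q m c (thetaCoeff p a b) n‖ ≤ B := by
  obtain ⟨g, hg, hb⟩ := exists_summable_bound_latticeTerm hp0 hp1 hq0 hq hp ha b m c
  exact ⟨_, exists_norm_tsum_le hg hb⟩

/-- One step of the bilateral Bailey lattice. -/
theorem tsum_latticeWeight_mul_latticeSum (hp0 : p ≠ 0) (hp1 : ‖p‖ < 1) (hq0 : q ≠ 0)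
    (hq : ‖q‖ < 1) (hp : p ^ 2 = q) {a : ℤ} (ha : 0 < a) (b m : ℤ) (i j : ℕ) (n : ℤ) :
    ∑' x, latticeWeight q m i j x *
        (qFacInv q (n - x) * latticeSum q m (i - (j + 1)) (thetaCoeff p a b) x)
      = latticeSum q m (i - j)
          (thetaCoeff p (a + 2) (b + 2 * (m - if j < i then 1 else 0))) n := by
  obtain ⟨C, hC0, hC⟩ := exists_bound_qFacInv hq0 hq
  obtain ⟨g, hg, hb⟩ := exists_summable_bound_latticeTerm hp0 hp1 hq0 hq hp ha b m (i - (j + 1))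
  refine tsum_mul_tsum_comm (summable_norm_latticeWeight hq0 hq m i j) (fun x => hC (n - x)) hg hb
    fun k => ?_
  rw [latticeTerm, ← thetaCoeff_mul_latticeWeight hp0 hp]
  -- Subtraction is truncated: i-(j+1) counts the lowered steps already made at the inner indices
  -- j+1, …, i-1, and is 0 while the steps are still plain.
  by_cases hji : j < i
  · have h := (hasSum_baileyKernel_lowered_iterate hq0 hq m k n (i - (j + 1))).mul_left
      (thetaCoeff p a b k)
    rw [show i - (j + 1) + 1 = i - j by omega] at h
    refine h.of_eq (fun x => ?_) ?_
    · simp only [latticeTerm, latticeWeight, geomTail, if_pos hji]; ring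
    · simp only [latticeWeight, geomTail, if_pos hji]; ring
  · have h := (hasSum_baileyKernel hq0 hq m k n).mul_left (thetaCoeff p a b k)
    have e1 : i - (j + 1) = 0 := by omega
    have e2 : i - j = 0 := by omega
    refine h.of_eq (fun x => ?_) ?_
    · simp only [latticeTerm, latticeWeight, geomTail, if_neg hji, e1, Finset.range_zero,
        Finset.sum_empty]
      ring_nf
    · simp only [latticeWeight, geomTail, if_neg hji, e2, Finset.range_zero, Finset.sum_empty]
      ring_nf

theorem tendsto_latticeSum (hp0 : p ≠ 0) (hp1 : ‖p‖ < 1) (hq0 : q ≠ 0)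
    (hq : ‖q‖ < 1) (hp : p ^ 2 = q) {a : ℤ} (ha : 0 < a) (b m : ℤ) (c : ℕ) :
    Tendsto (latticeSum q m c (thetaCoeff p a b)) atTop
      (𝓝 (∑' k, thetaCoeff p a b k * (1 + geomTail q m c k) *
        ((qPochInf q q)⁻¹ * (qPochInf q q)⁻¹))) := by
  obtain ⟨g, hg, hb⟩ := exists_summable_bound_latticeTerm hp0 hp1 hq0 hq hp ha b m c
  refine tendsto_tsum_of_dominated_convergence hg (fun k => ?_)
    (Eventually.of_forall fun n k => hb k n)
  rw [mul_assoc, add_mul, one_mul]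
  exact ((tendsto_baileyKernel hq _ _).add ((tendsto_baileyKernel hq _ _).const_mul _)).const_mul _

theorem tendsto_tsum_qFacInv_mul (hq0 : q ≠ 0) (hq : ‖q‖ < 1) {u β : ℤ → ℂ}
    (hu : Summable fun x => ‖u x‖) {B : ℝ} (hβ : ∀ x, ‖β x‖ ≤ B) :
    Tendsto (fun n => ∑' x, u x * (qFacInv q (n - x) * β x)) atTop
      (𝓝 ((qPochInf q q)⁻¹ * ∑' x, u x * β x)) := by
  obtain ⟨C, hC0, hC⟩ := exists_bound_qFacInv hq0 hq
  rw [← tsum_mul_left]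
  refine tendsto_tsum_of_dominated_convergence (hu.mul_right (C * B)) (fun x => ?_)
    (Eventually.of_forall fun n x => ?_)
  · rw [mul_left_comm]
    exact (((tendsto_qFacInv hq).comp
      (tendsto_atTop_add_const_right atTop (-x) tendsto_id)).mul_const _).const_mul _
  · rw [norm_mul, norm_mul]
    gcongr
    · exact hC _
    · exact hβ _

/-- The outermost variable has no link above it. Letting n → ∞ in one lattice step produces 1/(q)_∞
on the left and its square on the right, so one factor survives. -/
theorem tsum_latticeWeight_zero (hp0 : p ≠ 0) (hp1 : ‖p‖ < 1) (hq0 : q ≠ 0)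
    (hq : ‖q‖ < 1) (hp : p ^ 2 = q) {a : ℤ} (ha : 0 < a) (b m : ℤ) (i : ℕ) :
    ∑' x, latticeWeight q m i 0 x * latticeSum q m (i - 1) (thetaCoeff p a b) x
      = (∑' k, thetaCoeff p (a + 2) (b + 2 * (m - if 0 < i then 1 else 0)) k *
          (1 + geomTail q m i k)) / qPochInf q q := by
  obtain ⟨B, hB⟩ := exists_bound_latticeSum hp0 hp1 hq0 hq hp ha b m (i - 1)
  have h1 := tendsto_tsum_qFacInv_mul hq0 hq (summable_norm_latticeWeight hq0 hq m i 0) hB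
  have h2 := tendsto_latticeSum hp0 hp1 hq0 hq hp (a := a + 2) (by omega)
    (b + 2 * (m - if 0 < i then 1 else 0)) m i
  have h3 := tendsto_nhds_unique h1 (h2.congr fun n =>
    (tsum_latticeWeight_mul_latticeSum hp0 hp1 hq0 hq hp ha b m i 0 n).symm)
  have hQ := qPochInf_self_ne_zero hq
  rw [tsum_mul_right] at h3
  rw [eq_div_iff hQ]
  field_simp at h3
  linear_combination h3

/-- The multisum whose innermost factor is a term of the bilateral Bailey lattice. -/
theorem tsum_chainTerm_latticeSum (hp0 : p ≠ 0) (hp1 : ‖p‖ < 1) (hq0 : q ≠ 0)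
    (hq : ‖q‖ < 1) (hp : p ^ 2 = q) (m : ℤ) (i N : ℕ) {a : ℤ} (ha : 0 < a) (b : ℤ) :
    ∑' s, chainTerm (qFacInv q) N (latticeWeight q m i)
        (latticeSum q m (i - (N + 1)) (thetaCoeff p a b)) s
      = (∑' k, thetaCoeff p (a + 2 * (N + 1)) (b + 2 * ((N + 1) * m - min i (N + 1))) k *
          (1 + geomTail q m i k)) / qPochInf q q := by
  induction N generalizing a b with
  | zero =>
    rw [tsum_chainTerm_zero, tsum_latticeWeight_zero hp0 hp1 hq0 hq hp ha]
    have e : 2 * (m - if 0 < i then 1 else 0)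
        = 2 * (((0 : ℕ) + 1) * m - (min i (0 + 1) : ℕ)) := by
      split_ifs with h
      · rw [min_eq_right (by omega)]; simp
      · rw [min_eq_left (by omega), show i = 0 by omega]; simp
    rw [e]
    simp
  | succ N ih =>
    obtain ⟨C, hC0, hC⟩ := exists_bound_qFacInv hq0 hq
    obtain ⟨B, hB⟩ := exists_bound_latticeSum hp0 hp1 hq0 hq hp ha b m (i - (N + 1 + 1))
    rw [tsum_chainTerm_succ hC (fun j _ => summable_norm_latticeWeight hq0 hq m i j) hB]
    simp only [tsum_latticeWeight_mul_latticeSum hp0 hp1 hq0 hq hp ha]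
    have e : (b + 2 * (m - if N + 1 < i then 1 else 0))
          + 2 * ((N + 1) * m - (min i (N + 1) : ℕ))
        = b + 2 * (((N + 1 : ℕ) + 1) * m - (min i (N + 1 + 1) : ℕ)) := by
      split_ifs with h
      · rw [min_eq_right (by omega), min_eq_right (by omega)]; push_cast; ring
      · rw [min_eq_left (by omega), min_eq_left (by omega)]; push_cast; ring
    have e' : a + 2 + 2 * ((N : ℤ) + 1) = a + 2 * ((N + 1 : ℕ) + 1) := by push_cast; ring
    have h := ih (a := a + 2) (by omega) (b + 2 * (m - if N + 1 < i then 1 else 0))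
    rw [e, e'] at h
    exact h

theorem hasSum_thetaCoeff (hp0 : p ≠ 0) (hp1 : ‖p‖ < 1) (hq0 : q ≠ 0)
    (hq : ‖q‖ < 1) (hp : p ^ 2 = q) {r : ℕ} (hr : 0 < r) (b : ℤ) :
    HasSum (thetaCoeff p (2 * r) b)
      (qPochInf₃ (q ^ (2 * r)) (p ^ (b + 2 * r)) (p ^ (2 * r - b)) (q ^ (2 * r))) := by
  have hn : ∀ {z : ℂ}, ‖z‖ < 1 → ‖z ^ (2 * r)‖ < 1 := fun hz => by
    rw [norm_pow]; exact pow_lt_one₀ (norm_nonneg _) hz (by omega)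
  have hx : p ^ (b + 2 * r) ≠ 0 := zpow_ne_zero _ hp0
  have h := hasSum_jacobi_triple_product (p := p ^ (2 * r)) (q := q ^ (2 * r))
    (pow_ne_zero _ hp0) (hn hp1) (pow_ne_zero _ hq0) (hn hq) (by rw [← hp]; ring) hx
  have e : q ^ (2 * r) / p ^ (b + 2 * r) = p ^ (2 * r - b) := by
    rw [div_eq_iff hx, ← zpow_add₀ hp0, ← hp, ← pow_mul, ← zpow_natCast]
    congr 1; push_cast; ring
  rw [e] at h
  convert h using 1
  funext k
  rw [thetaCoeff, neg_eq_neg_one_mul (p ^ _), mul_zpow, mul_assoc ((-1) ^ k), ← zpow_mul,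
    ← zpow_natCast p (2 * r), ← zpow_mul, ← zpow_add₀ hp0]
  congr 2; push_cast; ring

/-- Each power y^l of y = q^{m+2k} moves the linear exponent b to b + 4l and leaves q^{ml}; l = 0
accounts for the 1. -/
theorem tsum_thetaCoeff_mul_geomTail (hp0 : p ≠ 0) (hp1 : ‖p‖ < 1) (hq0 : q ≠ 0)
    (hq : ‖q‖ < 1) (hp : p ^ 2 = q) {r : ℕ} (hr : 0 < r) (b m : ℤ) (i : ℕ) :
    ∑' k, thetaCoeff p (2 * r) b k * (1 + geomTail q m i k)
      = ∑ l ∈ Finset.range (i + 1), q ^ (m * l) *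
          qPochInf₃ (q ^ (2 * r)) (p ^ (b + 4 * l + 2 * r)) (p ^ (2 * r - (b + 4 * l)))
            (q ^ (2 * r)) := by
  refine (HasSum.of_eq (hasSum_sum fun (l : ℕ) _ => (hasSum_thetaCoeff hp0 hp1 hq0 hq hp hr
    (b + 4 * l)).mul_left (q ^ (m * (l : ℤ)))) (fun k => ?_) rfl).tsum_eq
  simp only [← thetaCoeff_mul_geom hp0 hp]
  rw [← Finset.mul_sum, Finset.sum_range_succ', geomTail, pow_zero, add_comm]

end lattice

/-! ### Assembly of the multisum. -/

/-- The reciprocal of `(-p^{m+1}; q)_j`, cut off at `j ≥ -⌊m/2⌋`. -/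
noncomputable def cutPochInv (p q : ℂ) (m : ℕ) (j : ℤ) : ℂ :=
  if -((m / 2 : ℕ) : ℤ) ≤ j then (qPoch (-p ^ (m + 1)) q j)⁻¹ else 0

theorem zpow_sum {ι : Type*} {q : ℂ} (hq0 : q ≠ 0) (t : Finset ι) (f : ι → ℤ) :
    q ^ (∑ j ∈ t, f j) = ∏ j ∈ t, q ^ f j := by
  classical
  induction t using Finset.induction_on with
  | empty => simp
  | insert a t ha ih => rw [Finset.sum_insert ha, Finset.prod_insert ha, zpow_add₀ hq0, ih]

section multisum

variable {p q : ℂ}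

theorem exists_bound_cutPoch (hp0 : p ≠ 0) (hp1 : ‖p‖ < 1) (hq0 : q ≠ 0) (hq : ‖q‖ < 1)
    (hp : p ^ 2 = q) (m : ℕ) :
    ∃ C, ∀ j, ‖cutPoch p q m j‖ ≤ C ∧ ‖cutPochInv p q m j‖ ≤ C := by
  have ha := qPochInf_neg_pow_mul_zpow_ne_zero hp0 hp1 hq hp m (j := -((m / 2 : ℕ) : ℤ)) le_rfl
  obtain ⟨C₁, h₁⟩ := exists_bound_qPochInf_mul_pow hq ha
  obtain ⟨C₂, h₂⟩ := exists_bound_inv_qPochInf_mul_pow hq ha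
  have hC₁ : 0 ≤ C₁ := (norm_nonneg _).trans (h₁ 0)
  have hC₂ : 0 ≤ C₂ := (norm_nonneg _).trans (h₂ 0)
  set A := ‖qPochInf (-p ^ (m + 1)) q‖
  -- With j = -⌊m/2⌋ + n, only a tail of the product depends on n. The two summands bound the
  -- factorial and its reciprocal, so their sum serves for both.
  refine ⟨A * C₂ + C₁ * A⁻¹, fun j => ?_⟩
  have hA : 0 ≤ A := norm_nonneg _
  rw [cutPoch, cutPochInv]
  split_ifs with hj
  · obtain ⟨n, rfl⟩ : ∃ n : ℕ, j = -((m / 2 : ℕ) : ℤ) + n :=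
      ⟨(j + (m / 2 : ℕ)).toNat, by omega⟩
    rw [qPoch, inv_div, zpow_add₀ hq0, zpow_natCast, ← mul_assoc, div_eq_mul_inv,
      div_eq_mul_inv, norm_mul, norm_mul, norm_inv (qPochInf (-p ^ (m + 1)) q)]
    have e₁ := mul_le_mul_of_nonneg_left (h₂ n) hA
    have e₂ := mul_le_mul_of_nonneg_right (h₁ n) (inv_nonneg.2 hA)
    have e₃ : 0 ≤ A * C₂ := by positivity
    have e₄ : 0 ≤ C₁ * A⁻¹ := by positivity
    constructor <;> linarith
  · rw [norm_zero]
    constructor <;> positivity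

/-- A nonzero kernel needs k ≤ n and n + m + k ≥ 0, hence 2n + m ≥ 0. The lower bound on the
summation variables is thus automatic here. -/
theorem latticeSum_zero_eq_zero (hq0 : q ≠ 0) (m : ℕ) (α : ℤ → ℂ) {n : ℤ}
    (hn : n < -((m / 2 : ℕ) : ℤ)) : latticeSum q m 0 α n = 0 := by
  refine (tsum_congr fun k => ?_).trans tsum_zero
  simp only [latticeTerm, geomTail, Finset.range_zero, Finset.sum_empty, zero_mul, add_zero]
  rcases lt_or_ge n k with hk | hk
  · rw [baileyKernel, qFacInv_neg hq0 (by omega : n - k < 0)]; simp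
  · rw [baileyKernel, qFacInv_neg hq0 (by omega : n + m + k < 0)]; simp

theorem cutPochInv_mul_cutPoch_mul_latticeSum (hp0 : p ≠ 0) (hp1 : ‖p‖ < 1) (hq0 : q ≠ 0)
    (hq : ‖q‖ < 1) (hp : p ^ 2 = q) (m : ℕ) (α : ℤ → ℂ) (n : ℤ) :
    cutPochInv p q m n * (cutPoch p q m n * latticeSum q m 0 α n) = latticeSum q m 0 α n := by
  by_cases hn : -((m / 2 : ℕ) : ℤ) ≤ n
  · have h1 := qPochInf_neg_pow_mul_zpow_ne_zero hp0 hp1 hq hp m hn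
    have h2 := qPochInf_neg_pow_mul_zpow_ne_zero hp0 hp1 hq hp m (j := 0) (by omega)
    rw [zpow_zero, mul_one] at h2
    have h3 : qPoch (-p ^ (m + 1)) q n ≠ 0 := div_ne_zero h2 h1
    rw [cutPochInv, cutPoch, if_pos hn, if_pos hn, inv_mul_cancel_left₀ h3]
  · rw [latticeSum_zero_eq_zero hq0 m α (not_le.1 hn)]; simp

/-- The innermost factor `(-1)^x q^{x(x-1)/2} [m+x; m+2x]` of the multisum. -/
noncomputable def unitBailey (p q : ℂ) (m : ℕ) (x : ℤ) : ℂ :=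
  (-1) ^ x * p ^ (x * (x - 1)) * qBinom q (m + x) (m + 2 * x)

theorem unitBailey_eq (hp0 : p ≠ 0) (hq0 : q ≠ 0) (hq : ‖q‖ < 1) (hp : p ^ 2 = q) (m : ℕ) (x : ℤ) :
    unitBailey p q m x = latticeSum q m 0 (thetaCoeff p 1 (-1)) x := by
  rw [unitBailey, ← (hasSum_basePair hp0 hq0 hq hp m x).tsum_eq]
  refine tsum_congr fun k => ?_
  simp only [latticeTerm, geomTail, Finset.range_zero, Finset.sum_empty, zero_mul, add_zero,
    thetaCoeff]
  congr 3; ring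

theorem summable_norm_cutWeight (hp0 : p ≠ 0) (hp1 : ‖p‖ < 1) (hq0 : q ≠ 0) (hq : ‖q‖ < 1)
    (hp : p ^ 2 = q) (m : ℕ) :
    Summable fun x : ℤ => ‖p ^ (x ^ 2 + m * x) * cutPoch p q m x‖ := by
  obtain ⟨C, hC⟩ := exists_bound_cutPoch hp0 hp1 hq0 hq hp m
  refine Summable.of_nonneg_of_le (fun _ => norm_nonneg _) (fun x => ?_)
    ((summable_norm_zpow_quadratic hp0 hp1 one_pos (m : ℤ)).mul_right C)
  rw [norm_mul, one_mul]
  gcongr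
  exact (hC x).1

/-- The innermost sum: the exponents k² - k and k² + mk add up to 2k² + (m-1)k, the starting point
of the lattice. -/
theorem tsum_cutWeight_mul_unitBailey (hp0 : p ≠ 0) (hp1 : ‖p‖ < 1) (hq0 : q ≠ 0) (hq : ‖q‖ < 1)
    (hp : p ^ 2 = q) (m : ℕ) (n : ℤ) :
    ∑' x : ℤ, p ^ (x ^ 2 + m * x) * cutPoch p q m x * (qFacInv q (n - x) * unitBailey p q m x)
      = cutPoch p q m n * latticeSum q m 0 (thetaCoeff p 2 (m - 1)) n := by
  obtain ⟨C, hC0, hC⟩ := exists_bound_qFacInv hq0 hq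
  obtain ⟨g, hg, hb⟩ := exists_summable_bound_latticeTerm hp0 hp1 hq0 hq hp one_pos (-1) m 0
  simp only [unitBailey_eq hp0 hq0 hq hp]
  rw [latticeSum, ← tsum_mul_left]
  refine tsum_mul_tsum_comm (summable_norm_cutWeight hp0 hp1 hq0 hq hp m) (fun x => hC (n - x))
    hg hb fun k => ?_
  refine ((hasSum_cutPoch_baileyKernel hp0 hp1 hq0 hq hp m k n).mul_left
    (thetaCoeff p 1 (-1) k)).of_eq (fun x => ?_) ?_
  · simp only [latticeTerm, geomTail, Finset.range_zero, Finset.sum_empty]; ring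
  · simp only [latticeTerm, geomTail, Finset.range_zero, Finset.sum_empty, zero_mul, add_zero]
    have e : thetaCoeff p 2 (m - 1) k = thetaCoeff p 1 (-1) k * p ^ (k ^ 2 + m * k) := by
      rw [thetaCoeff, thetaCoeff, mul_assoc, ← zpow_add₀ hp0]
      congr 2; ring
    rw [e]; ring

/-- The weights of the multisum in `R + 2` variables. -/
noncomputable def multisumWeight (p q : ℂ) (m i R j : ℕ) (x : ℤ) : ℂ :=
  if j = R + 1 then p ^ (x ^ 2 + m * x) * cutPoch p q m x
  else latticeWeight q m i j x * if j = R then cutPochInv p q m x else 1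

theorem prod_multisumWeight_init (p q : ℂ) (m i R : ℕ) (s : Fin (R + 1) → ℤ) :
    ∏ j : Fin (R + 1), multisumWeight p q m i R j (s j)
      = (∏ j : Fin (R + 1), latticeWeight q m i j (s j)) * cutPochInv p q m (s (Fin.last R)) := by
  have e : ∀ j : Fin R, multisumWeight p q m i R j.castSucc (s j.castSucc)
      = latticeWeight q m i j.castSucc (s j.castSucc) := fun j => by
    have := j.2
    rw [multisumWeight, if_neg (by simp; omega), if_neg (by simp; omega), mul_one]
  rw [Fin.prod_univ_castSucc, Fin.prod_univ_castSucc (n := R), Finset.prod_congr rfl fun j _ => e j,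
    multisumWeight, if_neg (by simp), if_pos (by simp), mul_assoc]

theorem summable_norm_multisumWeight (hp0 : p ≠ 0) (hp1 : ‖p‖ < 1) (hq0 : q ≠ 0) (hq : ‖q‖ < 1)
    (hp : p ^ 2 = q) (m i R j : ℕ) : Summable fun x => ‖multisumWeight p q m i R j x‖ := by
  obtain ⟨C, hC⟩ := exists_bound_cutPoch hp0 hp1 hq0 hq hp m
  simp only [multisumWeight]
  split_ifs
  · exact summable_norm_cutWeight hp0 hp1 hq0 hq hp m
  · refine Summable.of_nonneg_of_le (fun _ => norm_nonneg _) (fun x => ?_)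
      ((summable_norm_latticeWeight hq0 hq m i j).mul_right C)
    rw [norm_mul]
    gcongr
    exact (hC x).2
  · simpa using summable_norm_latticeWeight hq0 hq m i j

theorem hasSum_multisum (hp0 : p ≠ 0) (hp1 : ‖p‖ < 1) (hq0 : q ≠ 0) (hq : ‖q‖ < 1)
    (hp : p ^ 2 = q) (m i R : ℕ) (hi : i ≤ R + 1) :
    HasSum (chainTerm (qFacInv q) (R + 1) (multisumWeight p q m i R) (unitBailey p q m))
      ((∑ l ∈ Finset.range (i + 1), q ^ ((m : ℤ) * l) *
          qPochInf₃ (q ^ (2 * (R + 2)))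
            (p ^ ((m - 1 + 2 * ((R + 1) * (m : ℤ) - i)) + 4 * l + 2 * (R + 2 : ℕ)))
            (p ^ (2 * (R + 2 : ℕ) - ((m - 1 + 2 * ((R + 1) * (m : ℤ) - i)) + 4 * l)))
            (q ^ (2 * (R + 2)))) / qPochInf q q) := by
  obtain ⟨C, hC0, hC⟩ := exists_bound_qFacInv hq0 hq
  obtain ⟨B, hB⟩ := exists_bound_latticeSum hp0 hp1 hq0 hq hp one_pos (-1) m 0
  simp only [← unitBailey_eq hp0 hq0 hq hp] at hB
  have hw := summable_norm_multisumWeight hp0 hp1 hq0 hq hp m i R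
  refine (summable_norm_chainTerm hC (fun j _ => hw j) hB).of_norm.hasSum_iff.2 ?_
  -- The lattice starts after the innermost sum, at a = 2, b = m-1. Since i ≤ R+1, no lowered step
  -- has yet occurred and all i lie among the remaining variables.
  have hmain := tsum_chainTerm_latticeSum hp0 hp1 hq0 hq hp m i R two_pos (m - 1)
  rw [min_eq_left hi, Nat.sub_eq_zero_of_le hi,
    show (2 : ℤ) + 2 * (R + 1) = 2 * (R + 2 : ℕ) by push_cast; ring,
    tsum_thetaCoeff_mul_geomTail hp0 hp1 hq0 hq hp (by omega)] at hmain
  rw [← hmain, tsum_chainTerm_succ hC (fun j _ => hw j) hB]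
  refine tsum_congr fun s => ?_
  have e : ∀ y, ∑' x, multisumWeight p q m i R (R + 1) x *
      (qFacInv q (y - x) * unitBailey p q m x)
      = cutPoch p q m y * latticeSum q m 0 (thetaCoeff p 2 (m - 1)) y := fun y => by
    simp only [multisumWeight, if_true]
    exact tsum_cutWeight_mul_unitBailey hp0 hp1 hq0 hq hp m y
  simp only [chainTerm, e]
  have hlast := cutPochInv_mul_cutPoch_mul_latticeSum hp0 hp1 hq0 hq hp m
    (thetaCoeff p 2 (m - 1)) (s (Fin.last R))
  rw [prod_multisumWeight_init]
  linear_combination ((∏ j : Fin (R + 1), latticeWeight q m i j (s j)) *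
    ∏ j : Fin R, qFacInv q (s j.castSucc - s j.succ)) * hlast

theorem prod_multisumWeight (p q : ℂ) (m i R : ℕ) (s : Fin (R + 2) → ℤ) :
    ∏ j : Fin (R + 2), multisumWeight p q m i R j (s j)
      = (∏ j : Fin (R + 1), latticeWeight q m i j (s j.castSucc)) *
        cutPochInv p q m (s (Fin.last R).castSucc) *
        (p ^ (s (Fin.last (R + 1)) ^ 2 + m * s (Fin.last (R + 1))) *
          cutPoch p q m (s (Fin.last (R + 1)))) := by
  have h := prod_multisumWeight_init p q m i R fun j => s j.castSucc
  rw [Fin.prod_univ_castSucc (n := R + 1), ← h, Fin.val_last, multisumWeight, if_pos rfl]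
  rfl

/-- The links 1/(q)_{s_j - s_{j+1}} vanish unless the vector is decreasing, and `cutPoch` enforces
the bound on its last entry. The sum may therefore run over all integer vectors. -/
theorem support_multisum (hq0 : q ≠ 0) (m i R : ℕ) :
    Function.support (chainTerm (qFacInv q) (R + 1) (multisumWeight p q m i R) (unitBailey p q m))
      ⊆ multisumIndex m (R + 2) := by
  intro s hs
  have hne : chainTerm (qFacInv q) (R + 1) (multisumWeight p q m i R) (unitBailey p q m) s ≠ 0 := hs
  rw [chainTerm] at hne
  have h1 := Finset.prod_ne_zero_iff.1 (right_ne_zero_of_mul (left_ne_zero_of_mul hne))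
  have h2 := Finset.prod_ne_zero_iff.1 (left_ne_zero_of_mul (left_ne_zero_of_mul hne))
    (Fin.last (R + 1)) (Finset.mem_univ _)
  have hanti : Antitone s := Fin.antitone_iff_succ_le.2 fun j => by
    by_contra hlt
    exact h1 j (Finset.mem_univ _) (qFacInv_neg hq0 (by omega))
  refine ⟨hanti, fun j => le_trans ?_ (hanti (Fin.le_last j))⟩
  by_contra hlt
  refine h2 ?_
  rw [multisumWeight, if_pos (by simp), cutPoch, if_neg hlt, mul_zero]

end multisum

/-- Here `q` is a complex number with `0 < |q| < 1` and `p` is a fixed square root of `q`, so that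
`q^(n/2)` is `p ^ n`.  The multisum converges absolutely (`HasSum`) to the right-hand side. -/
theorem theorem1p18 (m r i : ℕ) (hr : 2 ≤ r) (hi : i ≤ r - 1)
    (q p : ℂ) (hq0 : q ≠ 0) (hq1 : ‖q‖ < 1) (hp : p ^ 2 = q) :
    HasSum
      (fun s : multisumIndex m r =>
        let t : Fin r → ℤ := s.1
        -- the entries `s_r` and `s_{r-1}`
        let sr : ℤ := t ⟨r - 1, by omega⟩
        let sr' : ℤ := t ⟨r - 2, by omega⟩
        p ^ (2 * ((∑ j : Fin r, t j ^ 2) + (m : ℤ) * (∑ j : Fin r, t j)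
                - (∑ j ∈ Finset.univ.filter (fun j : Fin r => (j : ℕ) < i), t j))
              - ((m : ℤ) + 1) * sr)
          * qPoch (-p ^ (m + 1)) q sr
          / ((∏ j : Fin (r - 1), qPoch q q (t ⟨j, by omega⟩ - t ⟨j + 1, by omega⟩))
              * qPoch (-p ^ (m + 1)) q sr')
          * (-1) ^ sr
          * qBinom q ((m : ℤ) + sr) ((m : ℤ) + 2 * sr))
      (∑ k ∈ Finset.range (i + 1),
        q ^ (m * k) *
          (qPochInf₃ (q ^ (2 * r))
              (p ^ (2 * (((m : ℤ) + 1) * r - i + 2 * k) - ((m : ℤ) + 1)))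
              (p ^ (2 * ((1 - (m : ℤ)) * r + i - 2 * k) + ((m : ℤ) + 1)))
              (q ^ (2 * r))
            / qPochInf q q)) := by
  obtain ⟨R, rfl⟩ : ∃ R, r = R + 2 := ⟨r - 2, by omega⟩
  have hp0 : p ≠ 0 := by
    rintro rfl
    exact hq0 (by rw [← hp]; simp)
  have hp1 : ‖p‖ < 1 := by
    rw [← hp, norm_pow] at hq1
    exact lt_of_pow_lt_pow_left₀ 2 zero_le_one (by simpa using hq1)
  have h := hasSum_multisum hp0 hp1 hq0 hq1 hp m i R hi
  rw [← hasSum_subtype_iff_of_support_subset (support_multisum hq0 m i R)] at h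
  convert h using 1
  · funext s
    obtain ⟨s, hs⟩ := s
    have hlink : (∏ j : Fin (R + 1), qPoch q q (s j.castSucc - s j.succ))⁻¹
        = ∏ j : Fin (R + 1), qFacInv q (s j.castSucc - s j.succ) := by
      rw [← Finset.prod_inv_distrib]
      exact Finset.prod_congr rfl fun j _ => inv_qPoch_self q _
    -- For x = s_r the exponent of p is 2x² + (m-1)x = (x² + mx) + x(x-1): the first part is the
    -- innermost weight, the second belongs to the initial Bailey pair.
    have hexp : p ^ (2 * ((∑ j, s j ^ 2) + (m : ℤ) * (∑ j, s j)
          - (∑ j ∈ Finset.univ.filter (fun j : Fin (R + 2) => (j : ℕ) < i), s j))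
            - ((m : ℤ) + 1) * s (Fin.last (R + 1)))
        = (∏ j : Fin (R + 1), latticeWeight q m i j (s j.castSucc)) *
          (p ^ (s (Fin.last (R + 1)) ^ 2 + m * s (Fin.last (R + 1))) *
            p ^ (s (Fin.last (R + 1)) * (s (Fin.last (R + 1)) - 1))) := by
      have e : (∑ j, s j ^ 2) + (m : ℤ) * (∑ j, s j)
          - (∑ j ∈ Finset.univ.filter (fun j : Fin (R + 2) => (j : ℕ) < i), s j)
          = ∑ j : Fin (R + 2), (s j ^ 2 + ((m : ℤ) - if (j : ℕ) < i then 1 else 0) * s j) := by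
        simp only [sub_mul, ite_mul, one_mul, zero_mul]
        rw [Finset.sum_add_distrib, Finset.sum_sub_distrib, Finset.mul_sum, Finset.sum_filter]
        ring
      have hi' : ¬ ((Fin.last (R + 1) : Fin (R + 2)) : ℕ) < i := by simp; omega
      rw [e, Fin.sum_univ_castSucc, if_neg hi']
      simp only [latticeWeight]
      rw [← zpow_sum hq0]
      simp only [Fin.val_castSucc, ← hp]
      rw [← zpow_natCast p, ← zpow_mul, ← zpow_add₀ hp0, ← zpow_add₀ hp0]
      congr 1
      push_cast
      ring
    have hcut : cutPoch p q m (s (Fin.last (R + 1))) = qPoch (-p ^ (m + 1)) q (s (Fin.last (R + 1)))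
      := if_pos (hs.2 _)
    have hcutInv : cutPochInv p q m (s (Fin.last R).castSucc)
        = (qPoch (-p ^ (m + 1)) q (s (Fin.last R).castSucc))⁻¹ := if_pos (hs.2 _)
    change p ^ (2 * ((∑ j, s j ^ 2) + (m : ℤ) * (∑ j, s j)
          - (∑ j ∈ Finset.univ.filter (fun j : Fin (R + 2) => (j : ℕ) < i), s j))
            - ((m : ℤ) + 1) * s (Fin.last (R + 1))) *
        qPoch (-p ^ (m + 1)) q (s (Fin.last (R + 1))) /
        ((∏ j : Fin (R + 1), qPoch q q (s j.castSucc - s j.succ)) *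
          qPoch (-p ^ (m + 1)) q (s (Fin.last R).castSucc)) * (-1) ^ s (Fin.last (R + 1)) *
        qBinom q (m + s (Fin.last (R + 1))) (m + 2 * s (Fin.last (R + 1)))
      = chainTerm (qFacInv q) (R + 1) (multisumWeight p q m i R) (unitBailey p q m) s
    rw [chainTerm, ← hlink, prod_multisumWeight, hexp, hcut, hcutInv, unitBailey, div_eq_mul_inv,
      mul_inv]
    ring
  · rw [Finset.sum_div]
    refine Finset.sum_congr rfl fun l _ => ?_
    rw [mul_div_assoc]
    congr 1
    congr 2 <;> congr 1 <;> push_cast <;> ring
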